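/- **Conventions.** Let $\Sigma'$ be a small (possibly infinite) many-sorted first-order signature. $\mathcal L_\infty(\Sigma')=\mathcal L_{\infty,\omega}(\Sigma')$ is the class of formulae with finitely many free variables built from atomic formulae with negation, $\forall x$, $\exists x$, and conjunctions and disjunctions over arbitrary small sets. A formula is *cartesian over* a theory $T$ if it is built from atomic formulae with finite conjunctions and existential quantifiers $\exists y\,\varphi$ for which $T$ proves (in regular logic) $\varphi\wedge\varphi[z/y]\vdash y=z$. A *cartesian theory* $T'$ in $\Sigma'$ is a set of sequents $\varphi\vdash_{\vec x}\psi$ that admits a well-founded partial order such that both sides of each axiom are cartesian over the set of axioms strictly preceding it. $\mathrm{Mod}(T')$ is the category of (set-based) models of $T'$ and all homomorphisms. For $\psi(\vec y)$ cartesian over $T'$, $\langle\vec y\mid\psi\rangle\in\mathrm{Mod}(T')$ denotes the model that represents the functor $a\mapsto\{\vec c\in a: a\models\psi(\vec c)\}$; a homomorphism $h\colon\langle\vec y\mid\psi\rangle\to a$ *takes $\vec y$ to $\vec c$* if it corresponds to $\vec c$ under this representation. A category $\mathcal C$ with a weak factorisation system $(\mathcal Q,\mathcal M)$ is *wooded*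 if it is locally small and well-powered, has an initial object, and $(\mathcal Q,\mathcal M)$ is *stable*: $\mathcal Q$ consists of epimorphisms, $\mathcal M$ of monomorphisms, and for all $e\in\mathcal Q$, $m\in\mathcal M$ with the same codomain the pullback of $e$ along $m$ exists and lies in $\mathcal Q$. Morphisms in $\mathcal M$ are called *embeddings*. An object $P$ is a *path* if the poset of subobjects of $P$ represented by embeddings is a finite chain. For an object $a$, let $\mathrm{Path}(a)$ be the poset of subobjects of $a$ represented by embeddings whose domain is a path; it is a tree with a least element $\bot_a$. Write $\prec$ for its covering relation. The game $\mathcal G(a,b)$ has as positions the pairs $(m,n)\in\mathrm{Path}(a)\times\mathrm{Path}(b)$; a position is *winning* if $\mathrm{dom}(m)\cong\mathrm{dom}(n)$. In a round from $(m,n)$, either Spoiler chooses $m'\succ m$ and Duplicator must answer with some $n'\succ n$, or Spoiler chooses $n'\succ n$ and Duplicator must answer with some $m'\succ m$; Duplicator wins the round if an answer is given and $(m',n')$ is winning, and the game continues from $(m',n')$. Write $a\simeq b$ ($a$ and $b$ are *back-and-forth equivalent*) if $(\bot_a,\bot_b)$ is winning and Duplicator has a strategy from $(\bot_a,\bot_b)$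 that wins every round. **Theorem.** Let $\mathcal C$ be a wooded category whose path embeddings are definable in $\Sigma'$, that is: 1. $\mathcal C=\mathrm{Mod}(T')$ for some cartesian theory $T'$ in $\Sigma'$; 2. every path of $\mathcal C$ is finitely presentable in $\mathcal C$; 3. for every path of the form $\langle\vec y\mid\psi\rangle$ there is a formula $\theta(\vec y)\in\mathcal L_\infty(\Sigma')$ such that, for every $a\in\mathcal C$ and every $h\colon\langle\vec y\mid\psi\rangle\to a$ taking $\vec y$ to $\vec c$, $h$ is an embedding if and only if $a\models\theta(\vec c)$. If $a,b\in\mathcal C$ satisfy the same sentences of $\mathcal L_\infty(\Sigma')$, then $a\simeq b$. -/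

import Mathlib

open CategoryTheory

universe u v w

namespace Wooded

/-! ### Many-sorted signatures, structures and homomorphisms -/

/-- A (small) many-sorted signature: sorts, function symbols `f : s₁ ⋯ sₙ → s` and
relation symbols `R ↪ s₁ ⋯ sₙ`. -/
structure Signature where
  Sorts : Type u
  Functions : List Sorts → Sorts → Type u
  Relations : List Sorts → Type u

/-- Tuples of elements of a sorted family, of the sorts listed in `Γ`. -/
abbrev Tuple {S : Type u} (A : S → Type w) (Γ : List S) : Type w :=
  ∀ i : Fin Γ.length, A (Γ.get i)

/-- Extend a tuple by one element, placed in front. -/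
def Tuple.cons {S : Type u} {A : S → Type w} {Γ : List S} {s : S} (x : A s) (e : Tuple A Γ) :
    Tuple A (s :: Γ) :=
  Fin.cases (motive := fun i => A ((s :: Γ).get i)) x e

/-- Structures for a signature; the carriers may be empty. -/
structure Struct (S : Signature.{u}) where
  carrier : S.Sorts → Type u
  funMap : ∀ {Γ : List S.Sorts} {s : S.Sorts}, S.Functions Γ s → Tuple carrier Γ → carrier s
  relMap : ∀ {Γ : List S.Sorts}, S.Relations Γ → Tuple carrier Γ → Prop

/-- Homomorphisms of structures. -/
@[ext]
structure Struct.Hom {S : Signature.{u}} (A B : Struct S) where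
  toFun : ∀ s : S.Sorts, A.carrier s → B.carrier s
  map_fun : ∀ {Γ : List S.Sorts} {s : S.Sorts} (f : S.Functions Γ s) (x : Tuple A.carrier Γ),
    toFun s (A.funMap f x) = B.funMap f (fun i => toFun _ (x i))
  map_rel : ∀ {Γ : List S.Sorts} (R : S.Relations Γ) (x : Tuple A.carrier Γ),
    A.relMap R x → B.relMap R (fun i => toFun _ (x i))

instance Struct.category (S : Signature.{u}) : Category.{u} (Struct S) where
  Hom A B := Struct.Hom A B
  id A :=
    { toFun := fun _ x => x
      map_fun := fun _ _ => rfl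
      map_rel := fun _ _ h => h }
  comp f g :=
    { toFun := fun s x => g.toFun s (f.toFun s x)
      map_fun := fun k x => by rw [f.map_fun, g.map_fun]
      map_rel := fun R x h => g.map_rel R _ (f.map_rel R x h) }

/-! ### Terms and formulae of infinitary first-order logic

A formula-in-context is a formula together with the finite list `Γ` of the sorts of its free
variables; variables are positions in `Γ`, and a quantifier binds position `0`. -/

/-- Terms-in-context of a given sort. -/
inductive Term (S : Signature.{u}) (Γ : List S.Sorts) : S.Sorts → Type u
  | var (i : Fin Γ.length) : Term S Γ (Γ.get i)
  | app {Δ : List S.Sorts} {s : S.Sorts} (f : S.Functions Δ s)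
      (ts : ∀ i : Fin Δ.length, Term S Γ (Δ.get i)) : Term S Γ s

/-- The value of a term under an assignment of its variables. -/
def Term.eval {S : Signature.{u}} (A : Struct S) {Γ : List S.Sorts} (e : Tuple A.carrier Γ) :
    ∀ {s : S.Sorts}, Term S Γ s → A.carrier s
  | _, .var i => e i
  | _, .app f ts => A.funMap f (fun i => (ts i).eval A e)

/-- The formulae-in-context of `L_∞`: finite contexts, first-order quantifiers, and conjunctions
and disjunctions indexed by arbitrary small sets. -/
inductive Formula (S : Signature.{u}) : List S.Sorts → Type (u + 1)
  | eq {Γ : List S.Sorts} {s : S.Sorts} (t t' : Term S Γ s) : Formula S Γ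
  | rel {Γ Δ : List S.Sorts} (R : S.Relations Δ) (ts : ∀ i : Fin Δ.length, Term S Γ (Δ.get i)) :
      Formula S Γ
  | not {Γ : List S.Sorts} (φ : Formula S Γ) : Formula S Γ
  | all {Γ : List S.Sorts} {s : S.Sorts} (φ : Formula S (s :: Γ)) : Formula S Γ
  | ex {Γ : List S.Sorts} {s : S.Sorts} (φ : Formula S (s :: Γ)) : Formula S Γ
  | iAnd {Γ : List S.Sorts} {I : Type u} (φ : I → Formula S Γ) : Formula S Γ
  | iOr {Γ : List S.Sorts} {I : Type u} (φ : I → Formula S Γ) : Formula S Γ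

/-- Satisfaction `A ⊨ φ(e)` for `L_∞`. -/
def Formula.Realize {S : Signature.{u}} (A : Struct S) :
    ∀ {Γ : List S.Sorts}, Formula S Γ → Tuple A.carrier Γ → Prop
  | _, .eq t t', e => t.eval A e = t'.eval A e
  | _, .rel R ts, e => A.relMap R (fun i => (ts i).eval A e)
  | _, .not φ, e => ¬ φ.Realize A e
  | _, .all φ, e => ∀ x, φ.Realize A (Tuple.cons x e)
  | _, .ex φ, e => ∃ x, φ.Realize A (Tuple.cons x e)
  | _, .iAnd φ, e => ∀ i, (φ i).Realize A e
  | _, .iOr φ, e => ∃ i, (φ i).Realize A e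

/-- `A` and `B` are equivalent in `L_∞`: they satisfy the same sentences. -/
def LInfEquiv {S : Signature.{u}} (A B : Struct S) : Prop :=
  ∀ φ : Formula S [], φ.Realize A (fun i => i.elim0) ↔ φ.Realize B (fun i => i.elim0)

/-! ### Regular formulae and their sequent calculus -/

/-- Regular formulae: built from atomic formulae with finite conjunctions and existential
quantifiers. -/
inductive RegFormula (S : Signature.{u}) : List S.Sorts → Type u
  | eq {Γ : List S.Sorts} {s : S.Sorts} (t t' : Term S Γ s) : RegFormula S Γ
  | rel {Γ Δ : List S.Sorts} (R : S.Relations Δ)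
      (ts : ∀ i : Fin Δ.length, Term S Γ (Δ.get i)) : RegFormula S Γ
  | top {Γ : List S.Sorts} : RegFormula S Γ
  | and {Γ : List S.Sorts} (φ ψ : RegFormula S Γ) : RegFormula S Γ
  | ex {Γ : List S.Sorts} {s : S.Sorts} (φ : RegFormula S (s :: Γ)) : RegFormula S Γ

/-- Satisfaction of regular formulae; `{e | φ.Realize A e}` is the interpretation of `φ` in `A`. -/
def RegFormula.Realize {S : Signature.{u}} (A : Struct S) :
    ∀ {Γ : List S.Sorts}, RegFormula S Γ → Tuple A.carrier Γ → Prop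
  | _, .eq t t', e => t.eval A e = t'.eval A e
  | _, .rel R ts, e => A.relMap R (fun i => (ts i).eval A e)
  | _, .top, _ => True
  | _, .and φ ψ, e => φ.Realize A e ∧ ψ.Realize A e
  | _, .ex φ, e => ∃ x, φ.Realize A (Tuple.cons x e)

/-- Simultaneous substitutions: a term in context `Δ` for each variable of `Γ`. -/
abbrev Subst (S : Signature.{u}) (Γ Δ : List S.Sorts) : Type u := Tuple (Term S Δ) Γ

/-- Substitution in terms. -/
def Term.subst {S : Signature.{u}} {Γ Δ : List S.Sorts} (σ : Subst S Γ Δ) :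
    ∀ {s : S.Sorts}, Term S Γ s → Term S Δ s
  | _, .var i => σ i
  | _, .app f ts => .app f (fun i => (ts i).subst σ)

/-- The substitution that regards the variables of `Γ` as variables of `s :: Γ`. -/
def Subst.weaken {S : Signature.{u}} (Γ : List S.Sorts) (s : S.Sorts) : Subst S Γ (s :: Γ) :=
  fun i => Term.var (S := S) (Γ := s :: Γ) i.succ

/-- The most recently declared variable. -/
def Term.newest {S : Signature.{u}} (Γ : List S.Sorts) (s : S.Sorts) : Term S (s :: Γ) s :=
  Term.var (S := S) (Γ := s :: Γ) (0 : Fin (Γ.length + 1))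

/-- Pass a substitution under a binder. -/
def Subst.lift {S : Signature.{u}} {Γ Δ : List S.Sorts} (σ : Subst S Γ Δ) (s : S.Sorts) :
    Subst S (s :: Γ) (s :: Δ) :=
  Tuple.cons (A := Term S (s :: Δ)) (Term.newest Δ s) (fun i => (σ i).subst (Subst.weaken Δ s))

/-- Substitution in regular formulae. -/
def RegFormula.subst {S : Signature.{u}} :
    ∀ {Γ Δ : List S.Sorts}, RegFormula S Γ → Subst S Γ Δ → RegFormula S Δ
  | _, _, .eq t t', σ => .eq (t.subst σ) (t'.subst σ)
  | _, _, .rel R ts, σ => .rel R (fun i => (ts i).subst σ)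
  | _, _, .top, _ => .top
  | _, _, .and φ ψ, σ => .and (φ.subst σ) (ψ.subst σ)
  | _, _, .ex (s := s) φ, σ => .ex (φ.subst (σ.lift s))

/-- Regard a formula in context `Γ` as a formula in context `s :: Γ`. -/
def RegFormula.weaken {S : Signature.{u}} {Γ : List S.Sorts} (φ : RegFormula S Γ) (s : S.Sorts) :
    RegFormula S (s :: Γ) :=
  φ.subst (Subst.weaken Γ s)

/-- A sequent `hyp ⊢_ctx concl` between regular formulae. -/
structure Sequent (S : Signature.{u}) where
  ctx : List S.Sorts
  hyp : RegFormula S ctx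
  concl : RegFormula S ctx

/-- A (regular) theory is a set of sequents, its axioms. -/
abbrev Theory (S : Signature.{u}) : Type u := Set (Sequent S)

/-- Derivability `φ ⊢_Γ ψ` from the axioms of `T` in the sequent calculus of regular logic. -/
inductive Derives {S : Signature.{u}} (T : Theory S) :
    ∀ {Γ : List S.Sorts}, RegFormula S Γ → RegFormula S Γ → Prop
  | ax {σ : Sequent S} : σ ∈ T → Derives T σ.hyp σ.concl
  | refl {Γ : List S.Sorts} (φ : RegFormula S Γ) : Derives T φ φ
  | cut {Γ : List S.Sorts} {φ ψ χ : RegFormula S Γ} :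
      Derives T φ ψ → Derives T ψ χ → Derives T φ χ
  | subst {Γ Δ : List S.Sorts} {φ ψ : RegFormula S Γ} (σ : Subst S Γ Δ) :
      Derives T φ ψ → Derives T (φ.subst σ) (ψ.subst σ)
  | eq_refl {Γ : List S.Sorts} {s : S.Sorts} (φ : RegFormula S Γ) (t : Term S Γ s) :
      Derives T φ (.eq t t)
  | eq_subst {Γ Δ : List S.Sorts} {χ : RegFormula S Δ} (φ : RegFormula S Γ) (σ τ : Subst S Γ Δ) :
      (∀ i, Derives T χ (.eq (σ i) (τ i))) → Derives T χ (φ.subst σ) → Derives T χ (φ.subst τ)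
  | top {Γ : List S.Sorts} (φ : RegFormula S Γ) : Derives T φ .top
  | and_left {Γ : List S.Sorts} (φ ψ : RegFormula S Γ) : Derives T (.and φ ψ) φ
  | and_right {Γ : List S.Sorts} (φ ψ : RegFormula S Γ) : Derives T (.and φ ψ) ψ
  | and_intro {Γ : List S.Sorts} {φ ψ χ : RegFormula S Γ} :
      Derives T φ ψ → Derives T φ χ → Derives T φ (.and ψ χ)
  | ex_left {Γ : List S.Sorts} {s : S.Sorts} {φ : RegFormula S (s :: Γ)} {ψ : RegFormula S Γ} :
      Derives T φ (ψ.weaken s) → Derives T (.ex φ) ψ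
  | ex_inv {Γ : List S.Sorts} {s : S.Sorts} {φ : RegFormula S (s :: Γ)} {ψ : RegFormula S Γ} :
      Derives T (.ex φ) ψ → Derives T φ (ψ.weaken s)
  | frobenius {Γ : List S.Sorts} {s : S.Sorts} (φ : RegFormula S Γ) (ψ : RegFormula S (s :: Γ)) :
      Derives T (.and φ (.ex ψ)) (.ex (.and (φ.weaken s) ψ))

/-! ### Cartesian theories and their models -/

/-- In the context `z, y, Γ`, the formula `φ(y, Γ)`. -/
def RegFormula.atOlder {S : Signature.{u}} {Γ : List S.Sorts} {s : S.Sorts}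
    (φ : RegFormula S (s :: Γ)) : RegFormula S (s :: s :: Γ) :=
  φ.weaken s

/-- In the context `z, y, Γ`, the formula `φ(z, Γ)`. -/
def RegFormula.atNewer {S : Signature.{u}} {Γ : List S.Sorts} {s : S.Sorts}
    (φ : RegFormula S (s :: Γ)) : RegFormula S (s :: s :: Γ) :=
  φ.subst ((Subst.weaken Γ s).lift s)

/-- `T` proves that there is at most one `y` with `φ`:
the sequent `φ(y) ∧ φ(z) ⊢ y = z` is derivable. -/
def ProvablyUnique {S : Signature.{u}} (T : Theory S) {Γ : List S.Sorts} {s : S.Sorts}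
    (φ : RegFormula S (s :: Γ)) : Prop :=
  Derives T (.and φ.atOlder φ.atNewer)
    (.eq ((Term.newest Γ s).subst (Subst.weaken (s :: Γ) s)) (Term.newest (s :: Γ) s))

/-- The formulae that are cartesian over `T`: built from atomic formulae with finite conjunctions
and existential quantifiers that are provably unique in `T`. -/
inductive IsCartesianOver {S : Signature.{u}} (T : Theory S) :
    ∀ {Γ : List S.Sorts}, RegFormula S Γ → Prop
  | eq {Γ : List S.Sorts} {s : S.Sorts} (t t' : Term S Γ s) : IsCartesianOver T (.eq t t')
  | rel {Γ Δ : List S.Sorts} (R : S.Relations Δ)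
      (ts : ∀ i : Fin Δ.length, Term S Γ (Δ.get i)) : IsCartesianOver T (.rel R ts)
  | top {Γ : List S.Sorts} : IsCartesianOver T (.top (Γ := Γ))
  | and {Γ : List S.Sorts} {φ ψ : RegFormula S Γ} :
      IsCartesianOver T φ → IsCartesianOver T ψ → IsCartesianOver T (.and φ ψ)
  | ex {Γ : List S.Sorts} {s : S.Sorts} {φ : RegFormula S (s :: Γ)} :
      IsCartesianOver T φ → ProvablyUnique T φ → IsCartesianOver T (.ex φ)

/-- `T` is a cartesian theory: there is a well-founded partial order on its axioms such that
each axiom is cartesian over the theory consisting of the axioms that strictly precede it. -/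
def Theory.IsCartesian {S : Signature.{u}} (T : Theory S) : Prop :=
  ∃ r : T → T → Prop, WellFounded r ∧ (∀ ρ σ τ, r ρ σ → r σ τ → r ρ τ) ∧
    ∀ σ : T, IsCartesianOver {τ | ∃ h : τ ∈ T, r ⟨τ, h⟩ σ} σ.1.hyp ∧
      IsCartesianOver {τ | ∃ h : τ ∈ T, r ⟨τ, h⟩ σ} σ.1.concl

/-- Being a model of `T`. -/
def Theory.isModel {S : Signature.{u}} (T : Theory S) : ObjectProperty (Struct S) :=
  fun A => ∀ σ ∈ T, ∀ e : Tuple A.carrier σ.ctx, σ.hyp.Realize A e → σ.concl.Realize A e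

/-- `Mod(T)`: models of `T` and all homomorphisms between them. -/
abbrev Mod {S : Signature.{u}} (T : Theory S) : Type (u + 1) := T.isModel.FullSubcategory

/-- The image of a tuple under a morphism of models. -/
def mapTuple {S : Signature.{u}} {T : Theory S} {A B : Mod T} (h : A ⟶ B) {Γ : List S.Sorts}
    (x : Tuple A.obj.carrier Γ) : Tuple B.obj.carrier Γ :=
  fun i => h.hom.toFun _ (x i)

/-- The model `P` together with the tuple `x` of its elements is the model `⟨y | ψ⟩` presented by
the generators `y` and the relation `ψ`: `x` satisfies `ψ`, and `h ↦ h(x)` is a bijection from the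
morphisms `P ⟶ A` to the tuples satisfying `ψ` in `A`, for every model `A`. In other words, `P`
represents the functor sending `A` to the interpretation of `ψ` in `A`, with universal element `x`;
and `h` takes `y` to `c` exactly when `h(x) = c`. -/
def IsPresentedBy {S : Signature.{u}} {T : Theory S} (P : Mod T) {Γ : List S.Sorts}
    (ψ : RegFormula S Γ) (x : Tuple P.obj.carrier Γ) : Prop :=
  ψ.Realize P.obj x ∧
    ∀ (A : Mod T) (c : Tuple A.obj.carrier Γ), ψ.Realize A.obj c → ∃! h : P ⟶ A, mapTuple h x = c

/-! ### Wooded categories, paths and back-and-forth games -/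

section Categorical

/-- `(Q, M)` is a stable proper factorisation system: a weak factorisation system whose quotients
(the morphisms in `Q`) are epimorphisms and whose embeddings (the morphisms in `M`) are
monomorphisms, such that the pullback of a quotient along an embedding exists and is a quotient. -/
structure IsStableFactorizationSystem {C : Type w} [Category.{v} C] (Q M : MorphismProperty C) :
    Prop where
  weak : MorphismProperty.IsWeakFactorizationSystem Q M
  epi : ∀ {X Y : C} (e : X ⟶ Y), Q e → Epi e
  mono : ∀ {X Y : C} (m : X ⟶ Y), M m → Mono m
  stable : ∀ {X Y Z : C} (e : X ⟶ Z) (m : Y ⟶ Z), Q e → M m →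
    ∃ (W : C) (m' : W ⟶ X) (e' : W ⟶ Y), IsPullback m' e' e m ∧ Q e'

/-- A category with a factorisation system is wooded if it is (locally small and) well-powered,
has an initial object, and the factorisation system is stable. Smallness is with respect to the
universe of the hom-sets, so local smallness holds by typing. -/
structure IsWooded {C : Type w} [Category.{v} C] (Q M : MorphismProperty C) : Prop where
  wellPowered : WellPowered.{v} C
  hasInitial : Limits.HasInitial C
  stable : IsStableFactorizationSystem Q M

variable {C : Type w} [Category.{v} C] (M : MorphismProperty C)

/-- The poset of embeddings into `X`, i.e. of subobjects of `X` represented by a morphism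
in `M`. -/
abbrev Emb (X : C) : Type (max w v) := {m : Subobject X // M m.arrow}

/-- An object `P` is a path if its poset of embeddings is a finite chain. -/
def IsPath (P : C) : Prop :=
  Finite (Emb M P) ∧ ∀ m n : Emb M P, m ≤ n ∨ n ≤ m

/-- The poset of path embeddings into `X`. -/
abbrev PathEmb (X : C) : Type (max w v) := {m : Emb M X // IsPath M (m.1 : C)}

/-- Positions of the game on `a` and `b`. -/
abbrev Position (a b : C) : Type (max w v) := PathEmb M a × PathEmb M b

variable {M} in
/-- The winning positions: those whose two path embeddings have isomorphic domains. -/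
def Position.Winning {a b : C} (p : Position M a b) : Prop :=
  Nonempty ((p.1.1.1 : C) ≅ (p.2.1.1 : C))

/-- A strategy of Duplicator: given the history of the game (the list of the positions reached so
far, the current one at the head) and a choice of Spoiler in one of the two objects, it
chooses a reply in the other object. -/
structure Strategy (a b : C) where
  replyRight : List (Position M a b) → PathEmb M a → PathEmb M b
  replyLeft : List (Position M a b) → PathEmb M b → PathEmb M a

variable {M} in
/-- The histories that can arise when the game is started in `p` and Duplicator follows the
strategy; in each round Spoiler chooses a cover of one of the two components of the current
position. A history with `t + 1` positions is one after `t` rounds. -/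
inductive Strategy.Reaches {a b : C} (σ : Strategy M a b) (p : Position M a b) :
    List (Position M a b) → Prop
  | start : σ.Reaches p [p]
  | left {m m' : PathEmb M a} {n : PathEmb M b} {H : List (Position M a b)} :
      σ.Reaches p ((m, n) :: H) → m ⋖ m' →
      σ.Reaches p ((m', σ.replyRight ((m, n) :: H) m') :: (m, n) :: H)
  | right {m : PathEmb M a} {n n' : PathEmb M b} {H : List (Position M a b)} :
      σ.Reaches p ((m, n) :: H) → n ⋖ n' →
      σ.Reaches p ((σ.replyLeft ((m, n) :: H) n', n') :: (m, n) :: H)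

variable {M} in
/-- Duplicator wins the game from the initial position `p`: this position is winning, and
some strategy of Duplicator wins every round, i.e. always replies legally (with a cover of the
corresponding component of the current position) and leads to a winning position. -/
def DuplicatorWins {a b : C} (p : Position M a b) : Prop :=
  p.Winning ∧ ∃ σ : Strategy M a b,
    ∀ (m : PathEmb M a) (n : PathEmb M b) (H : List (Position M a b)),
      σ.Reaches p ((m, n) :: H) →
        (∀ m' : PathEmb M a, m ⋖ m' →
          n ⋖ σ.replyRight ((m, n) :: H) m' ∧
            Position.Winning (m', σ.replyRight ((m, n) :: H) m')) ∧
        (∀ n' : PathEmb M b, n ⋖ n' →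
          m ⋖ σ.replyLeft ((m, n) :: H) n' ∧
            Position.Winning (σ.replyLeft ((m, n) :: H) n', n'))

/-- Back-and-forth equivalence `a ≃ b`: Duplicator wins the game from the pair of the roots (the
least elements) of the posets of path embeddings into `a` and `b`. -/
def BackAndForthEquiv (a b : C) : Prop :=
  ∃ (m : PathEmb M a) (n : PathEmb M b), IsBot m ∧ IsBot n ∧ DuplicatorWins (m, n)

end Categorical

/-- The path embeddings of `Mod(T)` (with embeddings the morphisms in `M`) are definable in the
signature of `T`: the theory `T` is cartesian, paths are finitely presentable, and for each path
`⟨y | ψ⟩` there is an `L_∞` formula `θ(y)` such that a morphism from the path which takes `y` to `c`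
is an embedding if and only if its codomain satisfies `θ(c)`. -/
structure PathEmbeddingsDefinable {S : Signature.{u}} (T : Theory S)
    (M : MorphismProperty (Mod T)) : Prop where
  cartesian : T.IsCartesian
  finitelyPresentable : ∀ P : Mod T, IsPath M P → IsFinitelyPresentable.{u} P
  definable : ∀ P : Mod T, IsPath M P →
    ∀ (Γ : List S.Sorts) (ψ : RegFormula S Γ) (x : Tuple P.obj.carrier Γ),
      IsCartesianOver T ψ → IsPresentedBy P ψ x →
        ∃ θ : Formula S Γ, ∀ (a : Mod T) (h : P ⟶ a), M h ↔ θ.Realize a.obj (mapTuple h x)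

end Wooded

namespace Wooded

/-! ### Substitution, soundness and preservation -/

section Semantics

variable {S : Signature.{u}}

/-! Duplicator maintains the following invariant (`Matched`): the position is represented by
embeddings f : P ⟶ a and g : P ⟶ b of one path P, and a tuple x presenting P has images f(x), g(x)
of the same `L_∞` type. Suppose Spoiler extends f along j : P ⟶ P' to f' : P' ⟶ a. The path P' is
finitely presentable, hence presented by a cartesian formula on a tuple y, which may be chosen to
contain j(x). Infinitary back-and-forth (`SameType.exists_cons`) finds a counterpart of f'(y) in b
over g(x). It satisfies the presenting formula, so it is g'(y) for some g' : P' ⟶ b; the formula θ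
transfers, so g' is an embedding; the equations identifying j(x) among the entries of y transfer, so
j ≫ g' = g (`exists_embedding_sameType`). Since covering is a property of j alone
(`PathEmb.covBy_of_covBy`), the reply is legal. Play starts at the quotient of the initial object
through which its map to a factors.

The main work is `exists_isPresentedBy`: finitely presentable models of a cartesian theory have
cartesian presentations. The argument is semantic. A finite set of quantifier-free facts about P is
"determined" by E if, in every model, its partial solutions are fixed by their values on E. The
elements mentioned by such sets form a submodel, because provably unique witnesses are determined by
their parameters (`genStruct_realize`). P is the directed union of the submodels generated by finite
sets, so one finite E generates P.

If no finite determined set of facts sufficed to extend its solutions from E to homomorphisms,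
counterexamples indexed by these sets would together give a homomorphism from P to their reduced
product along the tail filter. That reduced product is a model and a directed colimit of products
over tails, so finite presentability lifts the homomorphism to such a product; its components
contradict the choice of counterexamples (`exists_facts_forall_exists_hom`). A sufficient set of
facts, written as one quantifier-free formula, presents P. -/

theorem Tuple.cons_head_tail {X : Type u} {A : X → Type w} {Γ : List X} {s : X}
    (e : Tuple A (s :: Γ)) :
    Tuple.cons (e (0 : Fin (Γ.length + 1))) (fun i : Fin Γ.length => e i.succ) = e := by
  funext i
  refine Fin.cases ?_ (fun i => ?_) i <;> rfl

theorem Tuple.map_cons {X : Type u} {A B : X → Type w} (f : ∀ s, A s → B s) {Γ : List X} {s : X}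
    (x : A s) (e : Tuple A Γ) :
    (fun i => f _ (Tuple.cons x e i)) = Tuple.cons (f s x) (fun i => f _ (e i)) := by
  funext i
  refine Fin.cases ?_ (fun i => ?_) i <;> rfl

theorem Term.eval_subst (A : Struct S) {Γ Δ : List S.Sorts} (σ : Subst S Γ Δ)
    (e : Tuple A.carrier Δ) {s : S.Sorts} (t : Term S Γ s) :
    (t.subst σ).eval A e = t.eval A (fun i => (σ i).eval A e) := by
  induction t with
  | var i => rfl
  | app f ts ih =>
    change A.funMap f (fun i => ((ts i).subst σ).eval A e) = _
    simp only [ih]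
    rfl

theorem Subst.eval_weaken (A : Struct S) {Γ : List S.Sorts} {s : S.Sorts} (x : A.carrier s)
    (e : Tuple A.carrier Γ) :
    (fun i => (Subst.weaken Γ s i).eval A (Tuple.cons x e)) = e := rfl

theorem Subst.eval_lift (A : Struct S) {Γ Δ : List S.Sorts} (σ : Subst S Γ Δ) {s : S.Sorts}
    (x : A.carrier s) (e : Tuple A.carrier Δ) :
    (fun i => (σ.lift s i).eval A (Tuple.cons x e)) =
      Tuple.cons x (fun i => (σ i).eval A e) := by
  funext i
  refine Fin.cases rfl (fun i => ?_) i
  exact Term.eval_subst A (Subst.weaken Δ s) (Tuple.cons x e) (σ i)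

theorem RegFormula.realize_subst (A : Struct S) {Γ : List S.Sorts} (φ : RegFormula S Γ) :
    ∀ {Δ : List S.Sorts} (σ : Subst S Γ Δ) (e : Tuple A.carrier Δ),
      (φ.subst σ).Realize A e ↔ φ.Realize A (fun i => (σ i).eval A e) := by
  induction φ with
  | eq t t' =>
    intro Δ σ e
    simp only [RegFormula.subst, RegFormula.Realize, Term.eval_subst]
  | rel R ts =>
    intro Δ σ e
    simp only [RegFormula.subst, RegFormula.Realize, Term.eval_subst]
  | top => intro Δ σ e; rfl
  | and φ ψ ihφ ihψ =>
    intro Δ σ e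
    simp only [RegFormula.subst, RegFormula.Realize, ihφ, ihψ]
  | ex φ ih =>
    intro Δ σ e
    simp only [RegFormula.subst, RegFormula.Realize, ih, Subst.eval_lift]

theorem RegFormula.realize_weaken (A : Struct S) {Γ : List S.Sorts} (φ : RegFormula S Γ)
    {s : S.Sorts} (x : A.carrier s) (e : Tuple A.carrier Γ) :
    (φ.weaken s).Realize A (Tuple.cons x e) ↔ φ.Realize A e := by
  rw [RegFormula.weaken, RegFormula.realize_subst, Subst.eval_weaken]

/-- Soundness of the sequent calculus of regular logic. -/
theorem Derives.sound {T : Theory S} {A : Struct S} (hA : T.isModel A) {Γ : List S.Sorts}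
    {φ ψ : RegFormula S Γ} (h : Derives T φ ψ) :
    ∀ e : Tuple A.carrier Γ, φ.Realize A e → ψ.Realize A e := by
  induction h with
  | ax hσ => exact hA _ hσ
  | refl φ => exact fun _ h => h
  | cut _ _ ih ih' => exact fun e h => ih' e (ih e h)
  | subst σ _ ih =>
    intro e h
    rw [RegFormula.realize_subst] at h ⊢
    exact ih _ h
  | eq_refl φ t => exact fun _ _ => rfl
  | eq_subst φ σ τ _ _ ih ih' =>
    intro e h
    have h' := ih' e h
    rw [RegFormula.realize_subst] at h' ⊢
    have heq : (fun i => (σ i).eval A e) = fun i => (τ i).eval A e := funext fun i => ih i e h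
    rwa [← heq]
  | top φ => exact fun _ _ => trivial
  | and_left φ ψ => exact fun _ h => h.1
  | and_right φ ψ => exact fun _ h => h.2
  | and_intro _ _ ih ih' => exact fun e h => ⟨ih e h, ih' e h⟩
  | ex_left _ ih =>
    rintro e ⟨x, hx⟩
    exact (RegFormula.realize_weaken A _ x e).1 (ih _ hx)
  | ex_inv _ ih =>
    intro e h
    rw [← Tuple.cons_head_tail e] at h ⊢
    exact (RegFormula.realize_weaken A _ _ _).2 (ih _ ⟨_, h⟩)
  | frobenius φ ψ =>
    rintro e ⟨h, x, hx⟩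
    exact ⟨x, (RegFormula.realize_weaken A _ _ _).2 h, hx⟩

theorem ProvablyUnique.eq {T : Theory S} {A : Struct S} (hA : T.isModel A) {Γ : List S.Sorts}
    {s : S.Sorts} {φ : RegFormula S (s :: Γ)} (h : ProvablyUnique T φ) {x y : A.carrier s}
    {e : Tuple A.carrier Γ} (hx : φ.Realize A (Tuple.cons x e))
    (hy : φ.Realize A (Tuple.cons y e)) : x = y := by
  refine Derives.sound hA h (Tuple.cons y (Tuple.cons x e)) ⟨?_, ?_⟩
  · exact (RegFormula.realize_weaken A _ _ _).2 hx
  · rw [RegFormula.atNewer, RegFormula.realize_subst, Subst.eval_lift, Subst.eval_weaken]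
    exact hy

theorem Theory.isModel.mono {T T' : Theory S} (h : T' ⊆ T) {A : Struct S} (hA : T.isModel A) :
    T'.isModel A :=
  fun σ hσ => hA σ (h hσ)

theorem Struct.Hom.map_term {A B : Struct S} (h : Struct.Hom A B) {Γ : List S.Sorts}
    {s : S.Sorts} (t : Term S Γ s) (e : Tuple A.carrier Γ) :
    h.toFun s (t.eval A e) = t.eval B (fun i => h.toFun _ (e i)) := by
  induction t with
  | var i => rfl
  | app f ts ih =>
    simp only [Term.eval, h.map_fun, ih]

theorem RegFormula.Realize.map {A B : Struct S} (h : Struct.Hom A B) {Γ : List S.Sorts}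
    {φ : RegFormula S Γ} {e : Tuple A.carrier Γ} (hφ : φ.Realize A e) :
    φ.Realize B (fun i => h.toFun _ (e i)) := by
  induction φ with
  | eq t t' =>
    simp only [RegFormula.Realize] at hφ ⊢
    rw [← h.map_term, ← h.map_term, hφ]
  | rel R ts =>
    simp only [RegFormula.Realize, ← h.map_term] at hφ ⊢
    exact h.map_rel R _ hφ
  | top => trivial
  | and φ ψ ihφ ihψ => exact ⟨ihφ hφ.1, ihψ hφ.2⟩
  | ex φ ih =>
    obtain ⟨x, hx⟩ := hφ
    refine ⟨h.toFun _ x, ?_⟩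
    have := ih hx
    rwa [Tuple.map_cons h.toFun] at this

/-- Substitution in formulae of `L_∞`. -/
def Formula.subst : ∀ {Γ Δ : List S.Sorts}, Formula S Γ → Subst S Γ Δ → Formula S Δ
  | _, _, .eq t t', σ => .eq (t.subst σ) (t'.subst σ)
  | _, _, .rel R ts, σ => .rel R (fun i => (ts i).subst σ)
  | _, _, .not φ, σ => .not (φ.subst σ)
  | _, _, .all (s := s) φ, σ => .all (φ.subst (σ.lift s))
  | _, _, .ex (s := s) φ, σ => .ex (φ.subst (σ.lift s))
  | _, _, .iAnd φ, σ => .iAnd (fun i => (φ i).subst σ)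
  | _, _, .iOr φ, σ => .iOr (fun i => (φ i).subst σ)

theorem Formula.realize_subst (A : Struct S) {Γ : List S.Sorts} (φ : Formula S Γ) :
    ∀ {Δ : List S.Sorts} (σ : Subst S Γ Δ) (e : Tuple A.carrier Δ),
      (φ.subst σ).Realize A e ↔ φ.Realize A (fun i => (σ i).eval A e) := by
  induction φ with
  | eq t t' =>
    intro Δ σ e
    simp only [Formula.subst, Formula.Realize, Term.eval_subst]
  | rel R ts =>
    intro Δ σ e
    simp only [Formula.subst, Formula.Realize, Term.eval_subst]
  | not φ ih =>
    intro Δ σ e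
    simp only [Formula.subst, Formula.Realize, ih]
  | all φ ih =>
    intro Δ σ e
    simp only [Formula.subst, Formula.Realize, ih, Subst.eval_lift]
  | ex φ ih =>
    intro Δ σ e
    simp only [Formula.subst, Formula.Realize, ih, Subst.eval_lift]
  | iAnd φ ih =>
    intro Δ σ e
    simp only [Formula.subst, Formula.Realize, ih]
  | iOr φ ih =>
    intro Δ σ e
    simp only [Formula.subst, Formula.Realize, ih]

/-- Regular formulae as formulae of `L_∞`. -/
def RegFormula.toFormula : ∀ {Γ : List S.Sorts}, RegFormula S Γ → Formula S Γ
  | _, .eq t t' => .eq t t'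
  | _, .rel R ts => .rel R ts
  | _, .top => .iAnd (I := PEmpty) (fun i => i.elim)
  | _, .and φ ψ => .iAnd (I := ULift Bool) (fun i => bif i.down then φ.toFormula else ψ.toFormula)
  | _, .ex φ => .ex φ.toFormula

theorem RegFormula.realize_toFormula (A : Struct S) {Γ : List S.Sorts} (φ : RegFormula S Γ)
    (e : Tuple A.carrier Γ) : φ.toFormula.Realize A e ↔ φ.Realize A e := by
  induction φ with
  | eq t t' => rfl
  | rel R ts => rfl
  | top => simp [RegFormula.toFormula, Formula.Realize, RegFormula.Realize]
  | and φ ψ ihφ ihψ =>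
    simp only [RegFormula.toFormula, Formula.Realize, RegFormula.Realize, ULift.forall,
      Bool.forall_bool, cond_true, cond_false, ihφ, ihψ]
    exact and_comm
  | ex φ ih => simp only [RegFormula.toFormula, Formula.Realize, RegFormula.Realize, ih]

/-! ### Tuples with the same `L_∞` type -/

/-- The tuples `e` of `A` and `e'` of `B` satisfy the same formulae of `L_∞`. -/
def SameType (A B : Struct S) {Γ : List S.Sorts} (e : Tuple A.carrier Γ)
    (e' : Tuple B.carrier Γ) : Prop :=
  ∀ φ : Formula S Γ, φ.Realize A e ↔ φ.Realize B e'

theorem SameType.symm {A B : Struct S} {Γ : List S.Sorts} {e : Tuple A.carrier Γ}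
    {e' : Tuple B.carrier Γ} (h : SameType A B e e') : SameType B A e' e :=
  fun φ => (h φ).symm

theorem SameType.eval {A B : Struct S} {Γ Δ : List S.Sorts} {e : Tuple A.carrier Γ}
    {e' : Tuple B.carrier Γ} (h : SameType A B e e') (σ : Subst S Δ Γ) :
    SameType A B (fun i => (σ i).eval A e) (fun i => (σ i).eval B e') := by
  intro φ
  rw [← Formula.realize_subst, ← Formula.realize_subst]
  exact h _

/-- If every candidate y were separated from x by some formula φ_y, then ∃ v, ⋀_y φ_y(v) would hold
at e and fail at e'. The conjunction is indexed by a carrier of B, which is why arbitrary small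
conjunctions are needed. -/
theorem SameType.exists_cons {A B : Struct S} {Γ : List S.Sorts} {e : Tuple A.carrier Γ}
    {e' : Tuple B.carrier Γ} (h : SameType A B e e') {s : S.Sorts} (x : A.carrier s) :
    ∃ y : B.carrier s, SameType A B (Tuple.cons x e) (Tuple.cons y e') := by
  by_contra hne
  have key : ∀ y : B.carrier s, ∃ φ : Formula S (s :: Γ),
      φ.Realize A (Tuple.cons x e) ∧ ¬ φ.Realize B (Tuple.cons y e') := by
    intro y
    by_contra hy
    push Not at hy
    refine hne ⟨y, fun φ => ⟨hy φ, fun hB => ?_⟩⟩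
    by_contra hA
    -- Closure under negation turns one-sided preservation into equivalence.
    exact hy (.not φ) hA hB
  choose φ hφ hφ' using key
  obtain ⟨y, hy⟩ := (h (.ex (.iAnd φ))).1 ⟨x, hφ⟩
  exact hφ' y (hy y)

/-- Extension of tuples of the same type: any finite tuple of `A` has a counterpart in `B`. -/
theorem SameType.exists_extend {A B : Struct S} {Γ : List S.Sorts} {e : Tuple A.carrier Γ}
    {e' : Tuple B.carrier Γ} (h : SameType A B e e') {Δ : List S.Sorts} (c : Tuple A.carrier Δ) :
    ∃ (Θ : List S.Sorts) (E : Tuple A.carrier Θ) (E' : Tuple B.carrier Θ) (σ : Subst S Γ Θ)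
      (τ : Subst S Δ Θ), SameType A B E E' ∧ (fun i => (σ i).eval A E) = e ∧
        (fun i => (σ i).eval B E') = e' ∧ (fun i => (τ i).eval A E) = c := by
  induction Δ with
  | nil => exact ⟨Γ, e, e', fun i => .var i, fun i => i.elim0, h, rfl, rfl, funext fun i => i.elim0⟩
  | cons s Δ ih =>
    -- Entries of c are adjoined one at a time, last entry first. Reading e and c off the longer
    -- tuple by substitutions avoids index arithmetic in concatenated contexts.
    obtain ⟨Θ, E, E', σ, τ, hE, h₁, h₂, h₃⟩ := ih (fun i => c i.succ)
    obtain ⟨y, hy⟩ := hE.exists_cons (s := s) (c (0 : Fin (Δ.length + 1)))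
    refine ⟨s :: Θ, Tuple.cons (s := s) (c (0 : Fin (Δ.length + 1))) E, Tuple.cons y E',
      fun i => (σ i).subst (Subst.weaken Θ s), τ.lift s, hy, ?_, ?_, ?_⟩
    · exact (funext fun i => Term.eval_subst A _ _ (σ i)).trans h₁
    · exact (funext fun i => Term.eval_subst B _ _ (σ i)).trans h₂
    · exact (Subst.eval_lift A τ (s := s) (c (0 : Fin (Δ.length + 1))) E).trans
        (by rw [h₃]; exact Tuple.cons_head_tail c)

end Semantics

/-! ### Finite diagrams and partial assignments -/

section Facts

variable {S : Signature.{u}}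

/-- Regular formulae without quantifiers. -/
def RegFormula.IsQF : ∀ {Γ : List S.Sorts}, RegFormula S Γ → Prop
  | _, .eq _ _ => True
  | _, .rel _ _ => True
  | _, .top => True
  | _, .and φ ψ => φ.IsQF ∧ ψ.IsQF
  | _, .ex _ => False

theorem RegFormula.IsQF.isCartesianOver (T : Theory S) {Γ : List S.Sorts} {φ : RegFormula S Γ}
    (h : φ.IsQF) : IsCartesianOver T φ := by
  induction φ with
  | eq t t' => exact .eq t t'
  | rel R ts => exact .rel R ts
  | top => exact .top
  | and φ ψ ihφ ihψ => exact .and (ihφ h.1) (ihψ h.2)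
  | ex φ ih => exact h.elim

theorem RegFormula.IsQF.subst {Γ Δ : List S.Sorts} {φ : RegFormula S Γ} (h : φ.IsQF)
    (σ : Subst S Γ Δ) : (φ.subst σ).IsQF := by
  induction φ with
  | eq t t' => trivial
  | rel R ts => trivial
  | top => trivial
  | and φ ψ ihφ ihψ => exact ⟨ihφ h.1 σ, ihψ h.2 σ⟩
  | ex φ ih => exact h.elim

/-- The elements of a structure, of all sorts. -/
abbrev Struct.Elem (P : Struct S) : Type u := Σ s : S.Sorts, P.carrier s

/-- The set of the entries of a tuple. -/
def Tuple.entries {P : Struct S} {Γ : List S.Sorts} (e : Tuple P.carrier Γ) : Set P.Elem :=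
  Set.range fun i => ⟨Γ.get i, e i⟩

/-- A quantifier-free regular formula together with a tuple of `P` that satisfies it. -/
structure Fact (P : Struct S) where
  ctx : List S.Sorts
  tup : Tuple P.carrier ctx
  form : RegFormula S ctx
  qf : form.IsQF
  holds : form.Realize P tup

/-- Partial sorted maps between the carriers of two structures. -/
abbrev Assignment (P A : Struct S) : Type u := ∀ p : P.Elem, Option (A.carrier p.1)

variable {P A : Struct S}

/-- The partial map `d` is defined on the tuple `e`, with value `y`. -/
def Assignment.MapsTo (d : Assignment P A) {Γ : List S.Sorts} (e : Tuple P.carrier Γ)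
    (y : Tuple A.carrier Γ) : Prop :=
  ∀ i, d ⟨Γ.get i, e i⟩ = some (y i)

theorem Assignment.MapsTo.unique {d : Assignment P A} {Γ : List S.Sorts} {e : Tuple P.carrier Γ}
    {y z : Tuple A.carrier Γ} (hy : d.MapsTo e y) (hz : d.MapsTo e z) : y = z :=
  funext fun i => Option.some.inj ((hy i).symm.trans (hz i))

theorem Assignment.MapsTo.cons {d : Assignment P A} {Γ : List S.Sorts} {e : Tuple P.carrier Γ}
    {y : Tuple A.carrier Γ} (h : d.MapsTo e y) {s : S.Sorts} {p : P.carrier s} {a : A.carrier s}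
    (hp : d ⟨s, p⟩ = some a) : d.MapsTo (Tuple.cons p e) (Tuple.cons a y) := by
  intro i
  refine Fin.cases ?_ (fun i => ?_) i
  · exact hp
  · exact h i

theorem Assignment.exists_cons_of_mapsTo {d : Assignment P A} {Γ : List S.Sorts} {s : S.Sorts}
    {p : P.carrier s} {e : Tuple P.carrier Γ} {y : Tuple A.carrier (s :: Γ)}
    (h : d.MapsTo (Tuple.cons p e) y) :
    ∃ (a : A.carrier s) (z : Tuple A.carrier Γ), y = Tuple.cons a z ∧ d ⟨s, p⟩ = some a ∧
      d.MapsTo e z :=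
  ⟨y (0 : Fin (Γ.length + 1)), fun i => y i.succ, (Tuple.cons_head_tail y).symm,
    h (0 : Fin (Γ.length + 1)), fun i => h i.succ⟩

/-- The partial map `d` is defined on the elements that the fact mentions and preserves it. -/
def Fact.Sat (f : Fact P) (d : Assignment P A) : Prop :=
  ∃ y : Tuple A.carrier f.ctx, d.MapsTo f.tup y ∧ f.form.Realize A y

/-- The partial map `d` satisfies all facts in `F`. -/
def Assignment.Sat (d : Assignment P A) (F : Finset (Fact P)) : Prop :=
  ∀ f ∈ F, f.Sat d

theorem Assignment.Sat.mono {d : Assignment P A} {F F' : Finset (Fact P)} (h : d.Sat F')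
    (hF : F ⊆ F') : d.Sat F :=
  fun f hf => h f (hF hf)

/-- The elements mentioned by a set of facts. -/
def factSupport (F : Finset (Fact P)) : Set P.Elem :=
  {p | ∃ f ∈ F, p ∈ Tuple.entries f.tup}

theorem factSupport_mono {F F' : Finset (Fact P)} (h : F ⊆ F') :
    factSupport F ⊆ factSupport F' := by
  rintro p ⟨f, hf, hp⟩
  exact ⟨f, h hf, hp⟩

theorem finite_factSupport (F : Finset (Fact P)) : (factSupport F).Finite := by
  have : factSupport F = ⋃ f ∈ F, Tuple.entries f.tup := by
    ext p
    simp [factSupport]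
  rw [this]
  exact F.finite_toSet.biUnion fun f _ => Set.finite_range _

theorem Assignment.Sat.exists_eq_some {d : Assignment P A} {F : Finset (Fact P)} (h : d.Sat F)
    {p : P.Elem} (hp : p ∈ factSupport F) : ∃ a, d p = some a := by
  obtain ⟨f, hf, i, rfl⟩ := hp
  obtain ⟨y, hy, -⟩ := h f hf
  exact ⟨_, hy i⟩

theorem Assignment.Sat.exists_mapsTo {d : Assignment P A} {F : Finset (Fact P)} (h : d.Sat F)
    {Γ : List S.Sorts} {e : Tuple P.carrier Γ} (he : Tuple.entries e ⊆ factSupport F) :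
    ∃ y, d.MapsTo e y := by
  choose y hy using fun i => h.exists_eq_some (he ⟨i, rfl⟩)
  exact ⟨y, hy⟩

/-- The total map underlying a homomorphism. -/
def Struct.Hom.assignment (h : Struct.Hom P A) : Assignment P A :=
  fun p => some (h.toFun p.1 p.2)

theorem Struct.Hom.sat_assignment (h : Struct.Hom P A) (F : Finset (Fact P)) :
    h.assignment.Sat F :=
  fun f _ => ⟨fun i => h.toFun _ (f.tup i), fun _ => rfl, f.holds.map h⟩

/-- In models of `T`, a partial map that satisfies `F` is determined on the elements mentioned by
`F` by its values on `E`. -/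
def Determined (T : Theory S) (F : Finset (Fact P)) (E : Set P.Elem) : Prop :=
  ∀ (A : Struct S), T.isModel A → ∀ d d' : Assignment P A, d.Sat F → d'.Sat F →
    (∀ p ∈ E, d p = d' p) → ∀ p ∈ factSupport F, d p = d' p

theorem determined_of_subset (T : Theory S) {F : Finset (Fact P)} {E : Set P.Elem}
    (h : factSupport F ⊆ E) : Determined T F E :=
  fun _ _ _ _ _ _ hE p hp => hE p (h hp)

theorem Determined.mono {T : Theory S} {F : Finset (Fact P)} {E E' : Set P.Elem}
    (h : Determined T F E) (hE : E ⊆ E') : Determined T F E' :=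
  fun A hA d d' hd hd' h' => h A hA d d' hd hd' fun p hp => h' p (hE hp)

open Classical in
theorem factSupport_union (F F' : Finset (Fact P)) :
    factSupport (F ∪ F') = factSupport F ∪ factSupport F' := by
  ext p
  simp only [factSupport, Finset.mem_union, Set.mem_ofPred_eq, Set.mem_union, or_and_right,
    exists_or]

open Classical in
-- Determination is transitive: F' may take as parameters the elements that F has already
-- determined.
theorem Determined.union {T : Theory S} {F F' : Finset (Fact P)} {E E' : Set P.Elem}
    (h : Determined T F E) (h' : Determined T F' E') (hE : E' ⊆ E ∪ factSupport F) :
    Determined T (F ∪ F') E := by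
  intro A hA d d' hd hd' hdd p hp
  have h₁ := h A hA d d' (hd.mono Finset.subset_union_left) (hd'.mono Finset.subset_union_left) hdd
  rw [factSupport_union] at hp
  rcases hp with hp | hp
  · exact h₁ p hp
  · refine h' A hA d d' (hd.mono Finset.subset_union_right) (hd'.mono Finset.subset_union_right)
      (fun q hq => ?_) p hp
    rcases hE hq with hq | hq
    exacts [hdd q hq, h₁ q hq]

theorem factSupport_singleton (f : Fact P) : factSupport {f} = Tuple.entries f.tup := by
  simp [factSupport]

/-- A provably unique element is determined by the parameters of its definition. -/
theorem Determined.of_provablyUnique {T T' : Theory S} (hT : T' ⊆ T) {Γ : List S.Sorts}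
    {s : S.Sorts} {φ : RegFormula S (s :: Γ)} (hu : ProvablyUnique T' φ) {x : P.carrier s}
    {e : Tuple P.carrier Γ} {F : Finset (Fact P)}
    (h₁ : Tuple.entries (Tuple.cons x e) ⊆ factSupport F)
    (h₂ : Determined T F (Tuple.entries (Tuple.cons x e)))
    (h₃ : ∀ (A : Struct S), T.isModel A → ∀ (d : Assignment P A) (y : Tuple A.carrier (s :: Γ)),
      d.Sat F → d.MapsTo (Tuple.cons x e) y → φ.Realize A y) :
    Determined T F (Tuple.entries e) := by
  intro A hA d d' hd hd' hE
  refine h₂ A hA d d' hd hd' ?_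
  obtain ⟨y, hy⟩ := hd.exists_mapsTo h₁
  obtain ⟨y', hy'⟩ := hd'.exists_mapsTo h₁
  have hφ := h₃ A hA d y hd hy
  have hφ' := h₃ A hA d' y' hd' hy'
  obtain ⟨a, z, rfl, ha, hz⟩ := Assignment.exists_cons_of_mapsTo hy
  obtain ⟨a', z', rfl, ha', hz'⟩ := Assignment.exists_cons_of_mapsTo hy'
  have hzz : z = z' := by
    refine hz.unique fun i => ?_
    rw [hE _ ⟨i, rfl⟩]
    exact hz' i
  subst hzz
  -- Both values witness φ over the same parameters in a model, so they agree by soundness of the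
  -- derivation of uniqueness. Hence the two assignments agree on all of `Tuple.cons x e`, which
  -- determines the rest of F.
  have haa : a = a' := hu.eq (Theory.isModel.mono hT hA) hφ hφ'
  subst haa
  rintro _ ⟨i, rfl⟩
  exact (hy i).trans (hy' i).symm

/-- A cartesian formula that holds in `P` is witnessed by finitely many facts about elements
determined by its parameters. -/
theorem IsCartesianOver.exists_facts {T T' : Theory S} (hT : T' ⊆ T) {Γ : List S.Sorts}
    {φ : RegFormula S Γ} (hφ : IsCartesianOver T' φ) :
    ∀ {e : Tuple P.carrier Γ}, φ.Realize P e →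
      ∃ F : Finset (Fact P), Tuple.entries e ⊆ factSupport F ∧
        Determined T F (Tuple.entries e) ∧
        ∀ (A : Struct S), T.isModel A → ∀ (d : Assignment P A) (y : Tuple A.carrier Γ),
          d.Sat F → d.MapsTo e y → φ.Realize A y := by
  -- For a quantifier-free formula the single fact that it holds at e suffices, since that fact
  -- mentions exactly the entries of e.
  have atomic : ∀ {Γ : List S.Sorts} {φ : RegFormula S Γ}, φ.IsQF →
      ∀ {e : Tuple P.carrier Γ}, φ.Realize P e →
      ∃ F : Finset (Fact P), Tuple.entries e ⊆ factSupport F ∧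
        Determined T F (Tuple.entries e) ∧
        ∀ (A : Struct S), T.isModel A → ∀ (d : Assignment P A) (y : Tuple A.carrier Γ),
          d.Sat F → d.MapsTo e y → φ.Realize A y := by
    intro Γ φ hφ e he
    have hsupp := factSupport_singleton (P := P) ⟨Γ, e, φ, hφ, he⟩
    refine ⟨{⟨Γ, e, φ, hφ, he⟩}, hsupp.ge, determined_of_subset T hsupp.le, fun A hA d y hd hy => ?_⟩
    obtain ⟨z, hz, h⟩ := hd _ (Finset.mem_singleton_self _)
    rwa [hy.unique hz]
  classical
  induction hφ with
  | eq t t' => exact atomic (φ := .eq t t') trivial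
  | rel R ts => exact atomic (φ := .rel R ts) trivial
  | @top Γ => exact atomic (Γ := Γ) (φ := .top) trivial
  | and _ _ ih ih' =>
    rintro e ⟨h, h'⟩
    obtain ⟨F, h₁, h₂, h₃⟩ := ih h
    obtain ⟨F', -, h₂', h₃'⟩ := ih' h'
    refine ⟨F ∪ F', h₁.trans (factSupport_mono Finset.subset_union_left),
      h₂.union h₂' Set.subset_union_left, fun A hA d y hd hy => ⟨?_, ?_⟩⟩
    · exact h₃ A hA d y (hd.mono Finset.subset_union_left) hy
    · exact h₃' A hA d y (hd.mono Finset.subset_union_right) hy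
  | @ex Γ s φ _ hu ih =>
    rintro e ⟨x, hx⟩
    obtain ⟨F, h₁, h₂, h₃⟩ := ih hx
    -- The facts for φ at (x, e) serve unchanged; provable uniqueness removes x from the determining
    -- elements.
    refine ⟨F, ?_, .of_provablyUnique hT hu h₁ h₂ h₃, ?_⟩
    · rintro _ ⟨i, rfl⟩
      exact h₁ ⟨i.succ, rfl⟩
    · intro A hA d y hd hy
      obtain ⟨z, hz⟩ := hd.exists_mapsTo h₁
      have hφ := h₃ A hA d z hd hz
      obtain ⟨a, z, rfl, -, hz⟩ := Assignment.exists_cons_of_mapsTo hz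
      rw [hy.unique hz]
      exact ⟨a, hφ⟩

/-! ### The submodel generated by a set of elements -/

/-- The elements determined by `E` in all models of `T`. -/
def generatedBy (T : Theory S) (E : Set P.Elem) : Set P.Elem :=
  {p | ∃ F : Finset (Fact P), Determined T F E ∧ p ∈ factSupport F}

theorem generatedBy_mono (T : Theory S) {E E' : Set P.Elem} (h : E ⊆ E') :
    generatedBy T E ⊆ generatedBy T E' := by
  rintro p ⟨F, hF, hp⟩
  exact ⟨F, hF.mono h, hp⟩

/-- The fact that an element exists. -/
def Fact.elem (p : P.Elem) : Fact P where
  ctx := [p.1]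
  tup := Tuple.cons p.2 fun i => i.elim0
  form := .top
  qf := trivial
  holds := trivial

theorem Fact.entries_elem (p : P.Elem) : Tuple.entries (Fact.elem p).tup = {p} := by
  ext q
  constructor
  · rintro ⟨i, rfl⟩
    obtain rfl : i = (0 : Fin 1) := Subsingleton.elim (α := Fin 1) _ _
    rfl
  · rintro rfl
    exact ⟨(0 : Fin 1), rfl⟩

theorem subset_generatedBy (T : Theory S) (E : Set P.Elem) : E ⊆ generatedBy T E := by
  intro p hp
  have h : factSupport {Fact.elem p} = {p} := by rw [factSupport_singleton, Fact.entries_elem]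
  refine ⟨{Fact.elem p}, determined_of_subset T ?_, ?_⟩
  · rw [h]
    exact Set.singleton_subset_iff.2 hp
  · rw [h]
    rfl

/-- Finitely many elements of `generatedBy T E` are covered by one determined set of facts. -/
theorem exists_determined_of_finite {T : Theory S} {E : Set P.Elem} {X : Set P.Elem}
    (hX : X.Finite) (h : X ⊆ generatedBy T E) :
    ∃ F : Finset (Fact P), Determined T F E ∧ X ⊆ factSupport F := by
  classical
  induction X, hX using Set.Finite.induction_on with
  | empty =>
    refine ⟨∅, determined_of_subset T ?_, Set.empty_subset _⟩
    rintro p ⟨f, hf, -⟩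
    simp at hf
  | @insert p X _ _ ih =>
    obtain ⟨F, hF, hX⟩ := ih ((Set.subset_insert _ _).trans h)
    obtain ⟨F', hF', hp⟩ := h (Set.mem_insert _ _)
    refine ⟨F ∪ F', hF.union hF' Set.subset_union_left, Set.insert_subset ?_ ?_⟩
    · exact factSupport_mono Finset.subset_union_right hp
    · exact hX.trans (factSupport_mono Finset.subset_union_left)

/-- The fact that an operation takes a certain value on a tuple. -/
def Fact.func {Γ : List S.Sorts} {s : S.Sorts} (f : S.Functions Γ s) (x : Tuple P.carrier Γ) :
    Fact P where
  ctx := s :: Γ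
  tup := Tuple.cons (P.funMap f x) x
  form := .eq (Term.newest Γ s) (.app f (Subst.weaken Γ s))
  qf := trivial
  holds := rfl

theorem Fact.Sat.func {Γ : List S.Sorts} {s : S.Sorts} {f : S.Functions Γ s}
    {x : Tuple P.carrier Γ} {d : Assignment P A} (h : (Fact.func f x).Sat d) :
    ∃ y, d.MapsTo x y ∧ d ⟨s, P.funMap f x⟩ = some (A.funMap f y) := by
  obtain ⟨y, hy, hf⟩ := h
  obtain ⟨a, z, rfl, ha, hz⟩ := Assignment.exists_cons_of_mapsTo hy
  refine ⟨z, hz, ha.trans ?_⟩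
  exact congrArg some hf

/-- The fact that a relation holds. -/
def Fact.rel {Γ : List S.Sorts} (R : S.Relations Γ) (x : Tuple P.carrier Γ) (h : P.relMap R x) :
    Fact P where
  ctx := Γ
  tup := x
  form := .rel R fun i => .var i
  qf := trivial
  holds := h

/-- A fact set determining the entries of x is enlarged by the graph fact `Fact.func f x`, which
fixes the value at f(x) from the values at x. -/
theorem funMap_mem_generatedBy {T : Theory S} {E : Set P.Elem} {Γ : List S.Sorts} {s : S.Sorts}
    (f : S.Functions Γ s) (x : Tuple P.carrier Γ) (hx : ∀ i, ⟨Γ.get i, x i⟩ ∈ generatedBy T E) :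
    (⟨s, P.funMap f x⟩ : P.Elem) ∈ generatedBy T E := by
  classical
  obtain ⟨F, hF, hX⟩ := exists_determined_of_finite (X := Tuple.entries x) (Set.finite_range _)
    (by rintro _ ⟨i, rfl⟩; exact hx i)
  refine ⟨F ∪ {Fact.func f x}, hF.union (E' := Tuple.entries x) ?_ (hX.trans Set.subset_union_right),
    factSupport_mono Finset.subset_union_right ?_⟩
  · intro A _ d d' hd hd' hE p hp
    obtain ⟨y, hy, hf⟩ := (hd _ (Finset.mem_singleton_self _)).func
    obtain ⟨y', hy', hf'⟩ := (hd' _ (Finset.mem_singleton_self _)).func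
    have : y = y' := hy.unique fun i => (hE _ ⟨i, rfl⟩).trans (hy' i)
    subst this
    rw [factSupport_singleton] at hp
    obtain ⟨i, rfl⟩ := hp
    refine Fin.cases ?_ (fun i => ?_) i
    · exact hf.trans hf'.symm
    · exact hE _ ⟨i, rfl⟩
  · rw [factSupport_singleton]
    exact ⟨(0 : Fin (Γ.length + 1)), rfl⟩

/-- The substructure of `P` with carrier `generatedBy T E`. -/
def genStruct (T : Theory S) (P : Struct S) (E : Set P.Elem) : Struct S where
  carrier s := {x : P.carrier s // (⟨s, x⟩ : P.Elem) ∈ generatedBy T E}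
  funMap f x := ⟨P.funMap f fun i => (x i).1, funMap_mem_generatedBy f _ fun i => (x i).2⟩
  relMap R x := P.relMap R fun i => (x i).1

/-- The inclusion of `genStruct T P E`. -/
def genIncl (T : Theory S) (P : Struct S) (E : Set P.Elem) : Struct.Hom (genStruct T P E) P where
  toFun _ x := x.1
  map_fun _ _ := rfl
  map_rel _ _ h := h

/-- Cartesian formulae are reflected by the inclusion of the generated substructure: a provably
unique witness in P is determined by its parameters and so already lies in the substructure. Since
regular formulae are preserved by the inclusion, this makes the substructure a model when the theory
is cartesian. -/
theorem genStruct_realize {T T' : Theory S} (hT : T' ⊆ T) {E : Set P.Elem}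
    {Γ : List S.Sorts} {φ : RegFormula S Γ} (hφ : IsCartesianOver T' φ) :
    ∀ {e : Tuple (genStruct T P E).carrier Γ}, φ.Realize P (fun i => (e i).1) →
      φ.Realize (genStruct T P E) e := by
  induction hφ with
  | eq t t' =>
    intro e h
    refine Subtype.ext ?_
    have h₁ := (genIncl T P E).map_term t e
    have h₂ := (genIncl T P E).map_term t' e
    exact h₁.trans (Eq.trans h h₂.symm)
  | rel R ts =>
    intro e h
    have h₁ := fun i => (genIncl T P E).map_term (ts i) e
    change P.relMap R fun i => (genIncl T P E).toFun _ ((ts i).eval _ e)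
    simp only [h₁]
    exact h
  | top => exact fun _ => trivial
  | and _ _ ih ih' => exact fun h => ⟨ih h.1, ih' h.2⟩
  | @ex Γ s φ hφ hu ih =>
    rintro e ⟨x, hx⟩
    have hmem : (⟨s, x⟩ : P.Elem) ∈ generatedBy T E := by
      classical
      obtain ⟨F, hF, heF⟩ := exists_determined_of_finite
        (X := Tuple.entries fun i => (e i).1) (Set.finite_range _)
        (by rintro _ ⟨i, rfl⟩; exact (e i).2)
      obtain ⟨F', h₁, h₂, h₃⟩ := hφ.exists_facts (P := P) hT hx
      have h₂' := Determined.of_provablyUnique hT hu h₁ h₂ h₃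
      -- F determines the entries of e from E, and F' determines x from the entries of e.
      exact ⟨F ∪ F', hF.union h₂' (heF.trans Set.subset_union_right),
        factSupport_mono Finset.subset_union_right (h₁ ⟨(0 : Fin (Γ.length + 1)), rfl⟩)⟩
    refine ⟨⟨x, hmem⟩, ih ?_⟩
    have := Tuple.map_cons (genIncl T P E).toFun (Γ := Γ) (s := s) ⟨x, hmem⟩ e
    exact this ▸ hx

end Facts

/-! ### Reduced products -/

section ReducedProduct

variable {S : Signature.{u}}

/-- A total assignment that preserves operations and relations is a homomorphism. -/
noncomputable def Assignment.toHom {P A : Struct S} (d : Assignment P A)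
    (hd : ∀ p, ∃ a, d p = some a)
    (hfun : ∀ {Γ : List S.Sorts} {s : S.Sorts} (f : S.Functions Γ s) (x : Tuple P.carrier Γ),
      ∃ y, d.MapsTo x y ∧ d ⟨s, P.funMap f x⟩ = some (A.funMap f y))
    (hrel : ∀ {Γ : List S.Sorts} (R : S.Relations Γ) (x : Tuple P.carrier Γ), P.relMap R x →
      ∃ y, d.MapsTo x y ∧ A.relMap R y) : Struct.Hom P A where
  toFun s x := (hd ⟨s, x⟩).choose
  map_fun {Γ s} f x := by
    obtain ⟨y, hy, h⟩ := hfun f x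
    have hxy : (fun i => (hd ⟨Γ.get i, x i⟩).choose) = y :=
      Assignment.MapsTo.unique (fun i => (hd ⟨Γ.get i, x i⟩).choose_spec) hy
    rw [hxy]
    exact Option.some.inj ((hd ⟨s, P.funMap f x⟩).choose_spec.symm.trans h)
  map_rel {Γ} R x hR := by
    obtain ⟨y, hy, h⟩ := hrel R x hR
    have hxy : (fun i => (hd ⟨Γ.get i, x i⟩).choose) = y :=
      Assignment.MapsTo.unique (fun i => (hd ⟨Γ.get i, x i⟩).choose_spec) hy
    rwa [hxy]

theorem Assignment.toHom_spec {P A : Struct S} (d : Assignment P A)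
    (hd : ∀ p, ∃ a, d p = some a)
    (hfun : ∀ {Γ : List S.Sorts} {s : S.Sorts} (f : S.Functions Γ s) (x : Tuple P.carrier Γ),
      ∃ y, d.MapsTo x y ∧ d ⟨s, P.funMap f x⟩ = some (A.funMap f y))
    (hrel : ∀ {Γ : List S.Sorts} (R : S.Relations Γ) (x : Tuple P.carrier Γ), P.relMap R x →
      ∃ y, d.MapsTo x y ∧ A.relMap R y) (p : P.Elem) :
    d p = some ((d.toHom hd hfun hrel).toFun p.1 p.2) :=
  (hd p).choose_spec

variable {I : Type u} (A : I → Struct S) (l : Filter I)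

/-- Partial sections of the family of carriers of sort `s`, defined on a set of the filter. -/
abbrev PartialSection (s : S.Sorts) : Type u :=
  {f : ∀ i, Option ((A i).carrier s) // ∀ᶠ i in l, ∃ a, f i = some a}

/-- Two partial sections are identified if they agree on a set of the filter. -/
def germSetoid (s : S.Sorts) : Setoid (PartialSection A l s) where
  r f g := ∀ᶠ i in l, f.1 i = g.1 i
  iseqv :=
    ⟨fun _ => .of_forall fun _ => rfl, fun h => h.mono fun _ h => h.symm,
      fun h h' => (h.and h').mono fun _ h => h.1.trans h.2⟩

/-- Germs of partial sections. -/
abbrev Germ (s : S.Sorts) : Type u := Quotient (germSetoid A l s)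

variable {A l}

/-- A chosen representative of a germ. -/
noncomputable def Germ.val {s : S.Sorts} (x : Germ A l s) (i : I) : Option ((A i).carrier s) :=
  x.out.1 i

theorem Germ.eventually_some {s : S.Sorts} (x : Germ A l s) : ∀ᶠ i in l, ∃ a, x.val i = some a :=
  x.out.2

/-- The germ of a partial section. -/
def Germ.mk {s : S.Sorts} (f : ∀ i, Option ((A i).carrier s))
    (hf : ∀ᶠ i in l, ∃ a, f i = some a) : Germ A l s :=
  Quotient.mk (germSetoid A l s) ⟨f, hf⟩

theorem Germ.val_mk {s : S.Sorts} (f : ∀ i, Option ((A i).carrier s))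
    (hf : ∀ᶠ i in l, ∃ a, f i = some a) : ∀ᶠ i in l, (Germ.mk f hf).val i = f i :=
  Quotient.mk_out (s := germSetoid A l s) ⟨f, hf⟩

theorem Germ.eq_iff {s : S.Sorts} {x y : Germ A l s} : x = y ↔ ∀ᶠ i in l, x.val i = y.val i := by
  rw [← Quotient.out_equiv_out]
  rfl

theorem Germ.eventually_mapsTo {Γ : List S.Sorts} (x : Tuple (Germ A l) Γ) :
    ∀ᶠ i in l, ∃ y : Tuple (A i).carrier Γ, ∀ k, (x k).val i = some (y k) := by
  have := Filter.eventually_all.2 fun k => (x k).eventually_some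
  refine this.mono fun i hi => ?_
  choose y hy using hi
  exact ⟨y, hy⟩

open Classical in
/-- The partial section obtained by applying an operation to representatives of germs. -/
noncomputable def Germ.funSection {Γ : List S.Sorts} {s : S.Sorts} (f : S.Functions Γ s)
    (x : Tuple (Germ A l) Γ) (i : I) : Option ((A i).carrier s) :=
  if h : ∃ y : Tuple (A i).carrier Γ, ∀ k, (x k).val i = some (y k) then
    some ((A i).funMap f h.choose) else none

theorem Germ.eventually_funSection {Γ : List S.Sorts} {s : S.Sorts} (f : S.Functions Γ s)
    (x : Tuple (Germ A l) Γ) :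
    ∀ᶠ i in l, ∃ y : Tuple (A i).carrier Γ, (∀ k, (x k).val i = some (y k)) ∧
      Germ.funSection f x i = some ((A i).funMap f y) :=
  (Germ.eventually_mapsTo x).mono fun _ h => ⟨h.choose, h.choose_spec, dif_pos h⟩

variable (A l) in
/-- The reduced product of a family of structures modulo a filter. -/
noncomputable def reducedProduct : Struct S where
  carrier := Germ A l
  funMap f x :=
    Germ.mk (Germ.funSection f x) ((Germ.eventually_funSection f x).mono fun _ ⟨_, _, h⟩ => ⟨_, h⟩)
  relMap {Γ} R x :=
    ∀ᶠ i in l, ∃ y : Tuple (A i).carrier Γ, (∀ k, (x k).val i = some (y k)) ∧ (A i).relMap R y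

variable (A l) in
/-- The partial evaluation maps of a reduced product. -/
noncomputable def evalAssignment (i : I) : Assignment (reducedProduct A l) (A i) :=
  fun p => Germ.val p.2 i

theorem eventually_evalAssignment_funMap {Γ : List S.Sorts} {s : S.Sorts} (f : S.Functions Γ s)
    (x : Tuple (reducedProduct A l).carrier Γ) :
    ∀ᶠ i in l, ∃ y, (evalAssignment A l i).MapsTo x y ∧
      evalAssignment A l i ⟨s, (reducedProduct A l).funMap f x⟩ = some ((A i).funMap f y) := by
  have hf : ∀ᶠ i in l, ∃ a, Germ.funSection f x i = some a :=
    (Germ.eventually_funSection f x).mono fun _ ⟨_, _, h⟩ => ⟨_, h⟩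
  refine ((Germ.val_mk (Germ.funSection f x) hf).and (Germ.eventually_funSection f x)).mono ?_
  rintro i ⟨h, y, hy, h'⟩
  exact ⟨y, hy, h.trans h'⟩

theorem eventually_evalAssignment_eval {Γ : List S.Sorts} {s : S.Sorts} (t : Term S Γ s)
    (e : Tuple (reducedProduct A l).carrier Γ) :
    ∀ᶠ i in l, ∃ y, (evalAssignment A l i).MapsTo e y ∧
      evalAssignment A l i ⟨s, t.eval _ e⟩ = some (t.eval (A i) y) := by
  induction t with
  | var k =>
    refine (Germ.eventually_mapsTo e).mono ?_
    rintro i ⟨y, hy⟩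
    exact ⟨y, hy, hy k⟩
  | @app Δ s f ts ih =>
    refine (((Germ.eventually_mapsTo e).and (Filter.eventually_all.2 ih)).and
      (eventually_evalAssignment_funMap f fun k => (ts k).eval _ e)).mono ?_
    rintro i ⟨⟨⟨y, hy⟩, h⟩, z, hz, h'⟩
    refine ⟨y, hy, h'.trans ?_⟩
    -- The tuple z of argument values supplied by the fact about f must agree with the values of the
    -- subterms from the induction hypothesis. Arities are finite, so only finitely many sets of the
    -- filter are intersected.
    congr 2
    refine hz.unique fun k => ?_
    obtain ⟨y', hy', h''⟩ := h k
    rw [h'', hy'.unique hy]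

/-- A regular formula holds in a reduced product iff it holds almost everywhere. -/
theorem reducedProduct_realize_iff {Γ : List S.Sorts} (φ : RegFormula S Γ) :
    ∀ e : Tuple (reducedProduct A l).carrier Γ, φ.Realize (reducedProduct A l) e ↔
      ∀ᶠ i in l, ∃ y, (evalAssignment A l i).MapsTo e y ∧ φ.Realize (A i) y := by
  induction φ with
  | eq t t' =>
    intro e
    refine Germ.eq_iff.trans (Filter.eventually_congr ?_)
    refine ((eventually_evalAssignment_eval t e).and (eventually_evalAssignment_eval t' e)).mono ?_
    rintro i ⟨⟨y, hy, h⟩, y', hy', h'⟩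
    obtain rfl := hy.unique hy'
    have key : Germ.val (t.eval (reducedProduct A l) e) i =
        Germ.val (t'.eval (reducedProduct A l) e) i ↔ t.eval (A i) y = t'.eval (A i) y := by
      rw [show Germ.val (t.eval (reducedProduct A l) e) i = _ from h,
        show Germ.val (t'.eval (reducedProduct A l) e) i = _ from h', Option.some_inj]
    refine key.trans ⟨fun H => ⟨y, hy, H⟩, ?_⟩
    rintro ⟨z, hz, H⟩
    rwa [hy.unique hz]
  | rel R ts =>
    intro e
    refine Filter.eventually_congr ?_
    refine ((Germ.eventually_mapsTo e).and
      (Filter.eventually_all.2 fun k => eventually_evalAssignment_eval (ts k) e)).mono ?_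
    rintro i ⟨⟨y, hy⟩, h⟩
    have key : ∀ k, Germ.val ((ts k).eval (reducedProduct A l) e) i =
        some ((ts k).eval (A i) y) := by
      intro k
      obtain ⟨y', hy', h''⟩ := h k
      refine Eq.trans h'' ?_
      rw [hy'.unique hy]
    constructor
    · rintro ⟨z, hz, H⟩
      refine ⟨y, hy, ?_⟩
      have : z = fun k => (ts k).eval (A i) y :=
        funext fun k => Option.some.inj ((hz k).symm.trans (key k))
      rwa [this] at H
    · rintro ⟨z, hz, H⟩
      have hyz : y = z := funext fun k => Option.some.inj ((hy k).symm.trans (hz k))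
      subst hyz
      exact ⟨_, key, H⟩
  | top =>
    intro e
    refine ⟨fun _ => (Germ.eventually_mapsTo e).mono ?_, fun _ => trivial⟩
    rintro i ⟨y, hy⟩
    exact ⟨y, hy, trivial⟩
  | and φ ψ ihφ ihψ =>
    intro e
    simp only [RegFormula.Realize, ihφ, ihψ]
    rw [← Filter.eventually_and]
    refine Filter.eventually_congr (.of_forall fun i => ⟨?_, ?_⟩)
    · rintro ⟨⟨y, hy, h⟩, z, hz, h'⟩
      rw [hz.unique hy] at h'
      exact ⟨y, hy, h, h'⟩
    · rintro ⟨y, hy, h, h'⟩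
      exact ⟨⟨y, hy, h⟩, y, hy, h'⟩
  | @ex Γ s φ ih =>
    intro e
    simp only [RegFormula.Realize, ih]
    constructor
    · rintro ⟨x, hx⟩
      refine hx.mono ?_
      rintro i ⟨y, hy, h⟩
      obtain ⟨a, z, rfl, -, hz⟩ := Assignment.exists_cons_of_mapsTo hy
      exact ⟨z, hz, a, h⟩
    · intro H
      classical
      -- Witnesses are chosen wherever they exist. Elsewhere the section is undefined, since the
      -- carrier there may be empty.
      let g : ∀ i, Option ((A i).carrier s) := fun i =>
        if h : ∃ a, ∃ y, (evalAssignment A l i).MapsTo e y ∧ φ.Realize (A i) (Tuple.cons a y) then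
          some h.choose else none
      have hg : ∀ᶠ i in l, ∃ a, g i = some a ∧ ∃ y, (evalAssignment A l i).MapsTo e y ∧
          φ.Realize (A i) (Tuple.cons a y) := by
        refine H.mono ?_
        rintro i ⟨y, hy, a, h⟩
        have hex : ∃ a, ∃ y, (evalAssignment A l i).MapsTo e y ∧
          φ.Realize (A i) (Tuple.cons a y) := ⟨a, y, hy, h⟩
        exact ⟨_, dif_pos hex, hex.choose_spec⟩
      have hg' : ∀ᶠ i in l, ∃ a, g i = some a := hg.mono fun i ⟨a, ha, _⟩ => ⟨a, ha⟩
      refine ⟨Germ.mk g hg', ((Germ.val_mk g hg').and hg).mono ?_⟩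
      rintro i ⟨h, a, ha, y, hy, hφ⟩
      exact ⟨Tuple.cons a y, hy.cons (h.trans ha), hφ⟩

/-- Regular formulae hold in a reduced product exactly when they hold on a set of the filter, and on
that set each axiom applies index by index. -/
theorem reducedProduct_isModel {T : Theory S} (hA : ∀ i, T.isModel (A i)) :
    T.isModel (reducedProduct A l) := by
  intro σ hσ e h
  rw [reducedProduct_realize_iff] at h ⊢
  refine h.mono ?_
  rintro i ⟨y, hy, h⟩
  exact ⟨y, hy, hA i σ hσ y h⟩

/-- A family of partial maps that eventually preserve everything defines a homomorphism to the
reduced product. -/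
def reducedProductLift {P : Struct S} (d : ∀ i, Assignment P (A i))
    (hd : ∀ p, ∀ᶠ i in l, ∃ a, d i p = some a)
    (hfun : ∀ {Γ : List S.Sorts} {s : S.Sorts} (f : S.Functions Γ s) (x : Tuple P.carrier Γ),
      ∀ᶠ i in l, ∃ y, (d i).MapsTo x y ∧ d i ⟨s, P.funMap f x⟩ = some ((A i).funMap f y))
    (hrel : ∀ {Γ : List S.Sorts} (R : S.Relations Γ) (x : Tuple P.carrier Γ), P.relMap R x →
      ∀ᶠ i in l, ∃ y, (d i).MapsTo x y ∧ (A i).relMap R y) :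
    Struct.Hom P (reducedProduct A l) where
  toFun s x := Germ.mk (fun i => d i ⟨s, x⟩) (hd ⟨s, x⟩)
  map_fun {Γ s} f x := by
    refine Germ.eq_iff.2 ?_
    refine (((Germ.val_mk _ (hd ⟨s, P.funMap f x⟩)).and (hfun f x)).and
      ((Filter.eventually_all.2 fun k => Germ.val_mk _ (hd ⟨Γ.get k, x k⟩)).and
        (eventually_evalAssignment_funMap f fun k => Germ.mk _ (hd ⟨Γ.get k, x k⟩)))).mono ?_
    rintro i ⟨⟨h₁, y, hy, h₂⟩, h₃, z, hz, h₄⟩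
    refine (h₁.trans h₂).trans (Eq.trans ?_ h₄.symm)
    congr 2
    exact funext fun k => Option.some.inj ((hy k).symm.trans ((h₃ k).symm.trans (hz k)))
  map_rel {Γ} R x hR := by
    refine ((hrel R x hR).and
      (Filter.eventually_all.2 fun k => Germ.val_mk _ (hd ⟨Γ.get k, x k⟩))).mono ?_
    rintro i ⟨⟨y, hy, h⟩, h'⟩
    exact ⟨y, fun k => (h' k).trans (hy k), h⟩

/-- The homomorphism between reduced products induced by an inclusion of filters. -/
noncomputable def reducedProductRestrict {l l' : Filter I} (h : l' ≤ l) :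
    Struct.Hom (reducedProduct A l) (reducedProduct A l') :=
  reducedProductLift (evalAssignment A l) (fun p => h (Germ.eventually_some p.2))
    (fun f x => h (eventually_evalAssignment_funMap f x)) (fun _ _ hR => h hR)

theorem reducedProductRestrict_val {l l' : Filter I} (h : l' ≤ l) {s : S.Sorts}
    (x : Germ A l s) :
    ∀ᶠ i in l', Germ.val ((reducedProductRestrict (A := A) h).toFun s x) i = x.val i :=
  Germ.val_mk _ _

/-- Evaluation of a reduced product at an index contained in all sets of the filter. -/
noncomputable def reducedProductEval {l : Filter I} {i : I} (h : pure i ≤ l) :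
    Struct.Hom (reducedProduct A l) (A i) :=
  (evalAssignment A l i).toHom (fun p => h (Germ.eventually_some p.2))
    (fun f x => h (eventually_evalAssignment_funMap f x)) (fun _ _ hR => h hR)

theorem reducedProductEval_spec {l : Filter I} {i : I} (h : pure i ≤ l) {s : S.Sorts}
    (x : Germ A l s) :
    x.val i = some ((reducedProductEval (A := A) h).toFun s x) :=
  (evalAssignment A l i).toHom_spec (fun p => h (Germ.eventually_some p.2))
    (fun f x => h (eventually_evalAssignment_funMap f x)) (fun _ _ hR => h hR) ⟨s, x⟩

end ReducedProduct

/-! ### Directed colimits of models -/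

section Colimits

variable {S : Signature.{u}} {T : Theory S}

/-- A criterion for a cocone on a directed diagram of models to be a colimit. -/
theorem nonempty_isColimit_of_directed {J : Type u} [Preorder J] [IsDirectedOrder J] [Nonempty J]
    {F : J ⥤ Mod T} (c : Limits.Cocone F)
    (hsurj : ∀ s (x : c.pt.obj.carrier s), ∃ j y, (c.ι.app j).hom.toFun s y = x)
    (hinj : ∀ s j (y z : (F.obj j).obj.carrier s),
      (c.ι.app j).hom.toFun s y = (c.ι.app j).hom.toFun s z →
        ∃ k, ∃ h : j ⟶ k, (F.map h).hom.toFun s y = (F.map h).hom.toFun s z)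
    (hrel : ∀ (Γ : List S.Sorts) (R : S.Relations Γ) j (y : Tuple (F.obj j).obj.carrier Γ),
      c.pt.obj.relMap R (mapTuple (c.ι.app j) y) →
        ∃ k, ∃ h : j ⟶ k, (F.obj k).obj.relMap R (mapTuple (F.map h) y)) :
    Nonempty (Limits.IsColimit c) := by
  have w : ∀ (t : Limits.Cocone F) {j k : J} (h : j ⟶ k) {s : S.Sorts}
      (y : (F.obj j).obj.carrier s),
      (t.ι.app k).hom.toFun s ((F.map h).hom.toFun s y) = (t.ι.app j).hom.toFun s y := by
    intro t j k h s y
    rw [← t.w h]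
    rfl
  -- An identification made in the candidate colimit already happens at a finite stage, so every
  -- other cocone respects it. This makes `desc` below independent of the chosen preimages.
  have wd : ∀ (t : Limits.Cocone F) {s : S.Sorts} (j k : J) (y : (F.obj j).obj.carrier s)
      (z : (F.obj k).obj.carrier s),
      (c.ι.app j).hom.toFun s y = (c.ι.app k).hom.toFun s z →
        (t.ι.app j).hom.toFun s y = (t.ι.app k).hom.toFun s z := by
    intro t s j k y z h
    obtain ⟨m, hj, hk⟩ := exists_ge_ge j k
    rw [← w c (homOfLE hj), ← w c (homOfLE hk)] at h
    obtain ⟨n, hn, h⟩ := hinj _ _ _ _ h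
    rw [← w t (homOfLE hj), ← w t (homOfLE hk), ← w t hn, h, w t hn]
  have tup : ∀ {Γ : List S.Sorts} (x : Tuple c.pt.obj.carrier Γ),
      ∃ j, ∃ y : Tuple (F.obj j).obj.carrier Γ, mapTuple (c.ι.app j) y = x := by
    intro Γ x
    choose j y hy using fun i => hsurj _ (x i)
    obtain ⟨k, hk⟩ := Finite.exists_le j
    exact ⟨k, fun i => (F.map (homOfLE (hk i))).hom.toFun _ (y i),
      funext fun i => (w c (homOfLE (hk i)) (y i)).trans (hy i)⟩
  choose j y hy using hsurj
  let desc (t : Limits.Cocone F) : c.pt ⟶ t.pt := ObjectProperty.homMk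
    { toFun := fun s x => (t.ι.app (j s x)).hom.toFun s (y s x)
      map_fun := by
        intro Γ s f x
        obtain ⟨k, z, rfl⟩ := tup x
        have h₁ : ∀ i, (t.ι.app (j _ (mapTuple (c.ι.app k) z i))).hom.toFun _
            (y _ (mapTuple (c.ι.app k) z i)) = (t.ι.app k).hom.toFun _ (z i) :=
          fun i => wd t _ _ _ _ (hy _ _)
        simp only [h₁]
        refine Eq.trans ?_ ((t.ι.app k).hom.map_fun f z)
        exact wd t _ _ _ _ ((hy _ _).trans ((c.ι.app k).hom.map_fun f z).symm)
      map_rel := by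
        intro Γ R x hR
        obtain ⟨k, z, rfl⟩ := tup x
        have h₁ : ∀ i, (t.ι.app (j _ (mapTuple (c.ι.app k) z i))).hom.toFun _
            (y _ (mapTuple (c.ι.app k) z i)) = (t.ι.app k).hom.toFun _ (z i) :=
          fun i => wd t _ _ _ _ (hy _ _)
        simp only [h₁]
        obtain ⟨m, h, hR⟩ := hrel _ _ _ _ hR
        have := (t.ι.app m).hom.map_rel R _ hR
        simp only [mapTuple, w t] at this
        exact this }
  refine ⟨{ desc := desc, fac := fun t k => ?_, uniq := fun t m hm => ?_ }⟩
  · refine ObjectProperty.hom_ext _ (Struct.Hom.ext ?_)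
    funext s x
    exact wd t _ _ _ _ (hy _ _)
  · refine ObjectProperty.hom_ext _ (Struct.Hom.ext ?_)
    funext s x
    change _ = (t.ι.app (j s x)).hom.toFun s (y s x)
    rw [← hm (j s x)]
    exact congrArg _ (hy s x).symm

end Colimits

/-! ### Finitely presentable models are presented by cartesian formulae -/

section Presentation

variable {S : Signature.{u}} {T : Theory S}

/-- The submodel generated by a set of elements. -/
def genModel (hT : T.IsCartesian) (P : Mod T) (E : Set P.obj.Elem) : Mod T where
  obj := genStruct T P.obj E
  property := by
    obtain ⟨r, -, -, h⟩ := hT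
    intro σ hσ e he
    have hsub : {τ | ∃ h : τ ∈ T, r ⟨τ, h⟩ ⟨σ, hσ⟩} ⊆ T := fun τ hτ => hτ.1
    exact genStruct_realize hsub (h ⟨σ, hσ⟩).2 (P.property σ hσ _ (he.map (genIncl T P.obj E)))

/-- A finitely presentable model is generated by finitely many elements. -/
theorem exists_finite_generatedBy (hT : T.IsCartesian) (P : Mod T)
    [IsFinitelyPresentable.{u} P] :
    ∃ E : Finset P.obj.Elem, ∀ p, p ∈ generatedBy T (E : Set P.obj.Elem) := by
  classical
  let F : Finset P.obj.Elem ⥤ Mod T :=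
    { obj := fun E => genModel hT P E
      map := fun {E E'} h => ObjectProperty.homMk
        { toFun := fun s x => ⟨x.1, generatedBy_mono T (Finset.coe_subset.2 (leOfHom h)) x.2⟩
          map_fun := fun _ _ => rfl
          map_rel := fun _ _ h => h } }
  let c : Limits.Cocone F :=
    { pt := P
      ι := { app := fun E => ObjectProperty.homMk (genIncl T P.obj E) } }
  have hc : Nonempty (Limits.IsColimit c) := by
    refine nonempty_isColimit_of_directed c ?_ ?_ ?_
    · intro s x
      exact ⟨{⟨s, x⟩}, ⟨x, subset_generatedBy T _ (by simp)⟩, rfl⟩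
    · intro s j y z h
      exact ⟨j, 𝟙 j, Subtype.ext h⟩
    · intro Γ R j y h
      exact ⟨j, 𝟙 j, h⟩
  obtain ⟨hc⟩ := hc
  -- The identity factors through the inclusion of one finitely generated submodel, which is
  -- therefore all of P.
  obtain ⟨E, g, hg⟩ := IsFinitelyPresentable.exists_hom_of_isColimit hc (𝟙 P)
  refine ⟨E, fun p => ?_⟩
  have h : (g.hom.toFun p.1 p.2).1 = p.2 :=
    congrArg (fun k : P ⟶ P => k.hom.toFun p.1 p.2) hg
  have h' := (g.hom.toFun p.1 p.2).2
  rwa [h] at h'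

/-- The reduced product of a family of models. -/
noncomputable def reducedProductModel {I : Type u} (A : I → Mod T) (l : Filter I) : Mod T where
  obj := reducedProduct (fun i => (A i).obj) l
  property := reducedProduct_isModel fun i => (A i).property

/-- A morphism from a finitely presentable model to a reduced product over a directed set lifts to
the product over a final segment. -/
theorem exists_lift_reducedProduct {J : Type u} [Preorder J] [IsDirectedOrder J] [Nonempty J]
    (A : J → Mod T) (P : Mod T) [IsFinitelyPresentable.{u} P]
    (f : P ⟶ reducedProductModel A Filter.atTop) :
    ∃ (j : J) (g : ∀ k, j ≤ k → (P ⟶ A k)), ∀ p : P.obj.Elem,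
      ∀ᶠ k in Filter.atTop, ∃ h : j ≤ k,
        Germ.val (f.hom.toFun p.1 p.2) k = some ((g k h).hom.toFun p.1 p.2) := by
  have hle : ∀ j : J, (Filter.atTop : Filter J) ≤ Filter.principal (Set.Ici j) := fun j =>
    Filter.le_principal_iff.2 (Filter.mem_atTop j)
  have hle' : ∀ {j k : J}, j ≤ k →
      Filter.principal (Set.Ici k) ≤ Filter.principal (Set.Ici j) := fun h =>
    Filter.principal_mono.2 (Set.Ici_subset_Ici.2 h)
  -- Modulo the principal filter of `Set.Ici j`, the reduced product is the ordinary product of the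
  -- A k with j ≤ k. The reduced product modulo `Filter.atTop` is the colimit of these products
  -- under restriction.
  let F : J ⥤ Mod T :=
    { obj := fun j => reducedProductModel A (Filter.principal (Set.Ici j))
      map := fun h => ObjectProperty.homMk (reducedProductRestrict (hle' (leOfHom h)))
      map_id := by
        intro j
        refine ObjectProperty.hom_ext _ (Struct.Hom.ext ?_)
        funext s x
        exact Germ.eq_iff.2 (reducedProductRestrict_val le_rfl x)
      map_comp := by
        intro i j k h h'
        refine ObjectProperty.hom_ext _ (Struct.Hom.ext ?_)
        funext s x
        refine Germ.eq_iff.2 ?_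
        filter_upwards [reducedProductRestrict_val (hle' (leOfHom (h ≫ h'))) x,
          hle' (leOfHom h') (reducedProductRestrict_val (hle' (leOfHom h)) x),
          reducedProductRestrict_val (hle' (leOfHom h'))
            ((reducedProductRestrict (hle' (leOfHom h))).toFun s x)] with m h₁ h₂ h₃
        exact h₁.trans (h₂.symm.trans h₃.symm) }
  let c : Limits.Cocone F :=
    { pt := reducedProductModel A Filter.atTop
      ι :=
        { app := fun j => ObjectProperty.homMk (reducedProductRestrict (hle j))
          naturality := by
            intro i j h
            refine ObjectProperty.hom_ext _ (Struct.Hom.ext ?_)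
            funext s x
            refine Germ.eq_iff.2 ?_
            filter_upwards [hle j (reducedProductRestrict_val (hle' (leOfHom h)) x),
              reducedProductRestrict_val (hle i) x,
              reducedProductRestrict_val (hle j)
                ((reducedProductRestrict (hle' (leOfHom h))).toFun s x)] with m h₁ h₂ h₃
            exact h₃.trans (h₁.trans h₂.symm) } }
  have hc : Nonempty (Limits.IsColimit c) := by
    refine nonempty_isColimit_of_directed c ?_ ?_ ?_
    · intro s x
      obtain ⟨j, hj⟩ := Filter.eventually_atTop.1 (Germ.eventually_some x)
      refine ⟨j, Germ.mk (Germ.val x) (Filter.eventually_principal.2 hj), Germ.eq_iff.2 ?_⟩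
      filter_upwards [hle j (Germ.val_mk (Germ.val x) (Filter.eventually_principal.2 hj)),
        reducedProductRestrict_val (hle j)
          (Germ.mk (Germ.val x) (Filter.eventually_principal.2 hj))] with m h₁ h₂
      exact h₂.trans h₁
    · intro s j y z h
      have h' : ∀ᶠ k in Filter.atTop, Germ.val y k = Germ.val z k := by
        filter_upwards [reducedProductRestrict_val (hle j) y,
          reducedProductRestrict_val (hle j) z, Germ.eq_iff.1 h] with m h₁ h₂ h₃
        exact h₁.symm.trans (h₃.trans h₂)
      obtain ⟨k, hk⟩ := Filter.eventually_atTop.1 ((Filter.eventually_ge_atTop j).and h')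
      have hjk : j ≤ k := (hk k le_rfl).1
      refine ⟨k, homOfLE hjk, Germ.eq_iff.2 ?_⟩
      filter_upwards [reducedProductRestrict_val (hle' hjk) y,
        reducedProductRestrict_val (hle' hjk) z,
        Filter.eventually_principal.2 hk] with m h₁ h₂ h₃
      exact h₁.trans (h₃.2.trans h₂.symm)
    · intro Γ R j y h
      have h' : ∀ᶠ k in Filter.atTop, ∃ w : Tuple (A k).obj.carrier Γ,
          (∀ i, Germ.val (y i) k = some (w i)) ∧ (A k).obj.relMap R w := by
        filter_upwards [Filter.eventually_all.2 fun i => reducedProductRestrict_val (hle j) (y i),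
          h] with m h₁ h₂
        obtain ⟨w, hw, hR⟩ := h₂
        exact ⟨w, fun i => (h₁ i).symm.trans (hw i), hR⟩
      obtain ⟨k, hk⟩ := Filter.eventually_atTop.1 ((Filter.eventually_ge_atTop j).and h')
      have hjk : j ≤ k := (hk k le_rfl).1
      refine ⟨k, homOfLE hjk, ?_⟩
      change ∀ᶠ m in _, _
      filter_upwards [Filter.eventually_all.2 fun i =>
        reducedProductRestrict_val (hle' hjk) (y i), Filter.eventually_principal.2 hk] with m h₁ h₂
      obtain ⟨-, w, hw, hR⟩ := h₂
      exact ⟨w, fun i => (h₁ i).trans (hw i), hR⟩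
  obtain ⟨hc⟩ := hc
  obtain ⟨j, g, hg⟩ := IsFinitelyPresentable.exists_hom_of_isColimit hc f
  have hpure : ∀ k, j ≤ k → pure k ≤ Filter.principal (Set.Ici j) := fun k h =>
    (Filter.pure_le_principal k).2 h
  -- The lift to the product over the tail is followed by the projection to the k-th factor.
  refine ⟨j, fun k h => g ≫ ObjectProperty.homMk (reducedProductEval (hpure k h)), fun p => ?_⟩
  have hp : (reducedProductRestrict (hle j)).toFun p.1 (g.hom.toFun p.1 p.2) =
      f.hom.toFun p.1 p.2 := congrArg (fun k : P ⟶ _ => k.hom.toFun p.1 p.2) hg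
  filter_upwards [reducedProductRestrict_val (hle j) (g.hom.toFun p.1 p.2),
    Filter.eventually_ge_atTop j] with k h₁ h₂
  refine ⟨h₂, ?_⟩
  rw [← hp]
  exact h₁.trans (reducedProductEval_spec (hpure k h₂) _)

theorem Fact.Sat.mapsTo_of_elem {P A : Struct S} {d : Assignment P A} {p : P.Elem}
    (h : (Fact.elem p).Sat d) : ∃ a, d p = some a := by
  obtain ⟨y, hy, -⟩ := h
  exact ⟨_, hy (0 : Fin 1)⟩

/-- If `E` generates the finitely presentable model `P`, then finitely many facts determined by `E`
suffice to extend partial maps on `E` to homomorphisms. -/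
theorem exists_facts_forall_exists_hom (P : Mod T) [IsFinitelyPresentable.{u} P]
    (E : Finset P.obj.Elem) (hE : ∀ p, p ∈ generatedBy T (E : Set P.obj.Elem))
    (X : Finset P.obj.Elem) :
    ∃ F : Finset (Fact P.obj), Determined T F E ∧ (X : Set P.obj.Elem) ⊆ factSupport F ∧
      ∀ (A : Mod T) (d : Assignment P.obj A.obj), d.Sat F →
        ∃ h : P ⟶ A, ∀ p ∈ E, d p = h.hom.assignment p := by
  classical
  by_contra hne
  push Not at hne
  -- The index set consists of the admissible fact sets ordered by inclusion; it is directed by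
  -- unions. Each F carries a model and a solution of F with no homomorphism agreeing with it on E.
  let J : Type u := {F : Finset (Fact P.obj) //
    Determined T F E ∧ (X : Set P.obj.Elem) ⊆ factSupport F}
  have hdir : IsDirectedOrder J := ⟨fun F F' =>
    ⟨⟨F.1 ∪ F'.1, F.2.1.union F'.2.1 Set.subset_union_left,
      F.2.2.trans (factSupport_mono Finset.subset_union_left)⟩,
      Finset.subset_union_left, Finset.subset_union_right⟩⟩
  have hJ : Nonempty J := by
    obtain ⟨F, hF⟩ := exists_determined_of_finite (T := T) X.finite_toSet fun p _ => hE p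
    exact ⟨⟨F, hF⟩⟩
  choose A d hd hh using fun F : J => hne F.1 F.2.1 F.2.2
  -- Any single fact f belongs to some admissible set: since E generates P, its entries can be
  -- covered by determined facts, after which adding f keeps the set determined. Hence f is
  -- satisfied at all larger indices.
  have hfact : ∀ f : Fact P.obj, ∀ᶠ F in Filter.atTop, f.Sat (d F) := by
    intro f
    obtain ⟨F₀⟩ := hJ
    obtain ⟨F₁, hF₁, hf⟩ := exists_determined_of_finite (T := T) (X := Tuple.entries f.tup)
      (Set.finite_range _) fun p _ => hE p
    have hsupp : factSupport {f} ⊆ E ∪ factSupport (F₀.1 ∪ F₁) := by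
      rw [factSupport_singleton]
      exact hf.trans ((factSupport_mono Finset.subset_union_right).trans Set.subset_union_right)
    let F₂ : J := ⟨(F₀.1 ∪ F₁) ∪ {f},
      (F₀.2.1.union hF₁ Set.subset_union_left).union (determined_of_subset T subset_rfl) hsupp,
      F₀.2.2.trans (factSupport_mono (Finset.subset_union_left.trans Finset.subset_union_left))⟩
    filter_upwards [Filter.eventually_ge_atTop F₂] with F hF
    exact hd F f (hF (Finset.mem_union_right _ (Finset.mem_singleton_self f)))
  let φ : P ⟶ reducedProductModel A Filter.atTop := ObjectProperty.homMk
    (reducedProductLift d (fun p => (hfact (Fact.elem p)).mono fun _ h => h.mapsTo_of_elem)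
      (fun f x => (hfact (Fact.func f x)).mono fun _ h => h.func)
      (fun R x hR => hfact (Fact.rel R x hR)))
  obtain ⟨j, g, hg⟩ := exists_lift_reducedProduct A P φ
  -- For each element of E, the components of the lift eventually agree with d. As E is finite, one
  -- index works for all of them, against the choice of counterexample there.
  have key : ∀ᶠ F in Filter.atTop, ∀ p ∈ E, ∃ h : j ≤ F, d F p = (g F h).hom.assignment p := by
    refine (Filter.eventually_all_finset E).2 fun p _ => ?_
    filter_upwards [hg p, Germ.val_mk (fun F => d F p)
      ((hfact (Fact.elem p)).mono fun _ h => h.mapsTo_of_elem)] with F h₁ h₂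
    obtain ⟨h, h₁⟩ := h₁
    exact ⟨h, h₂.symm.trans h₁⟩
  obtain ⟨F, h₁, h₂⟩ := (key.and (Filter.eventually_ge_atTop j)).exists
  obtain ⟨p, hp, hne⟩ := hh F (g F h₂)
  obtain ⟨_, h⟩ := h₁ p hp
  exact hne h

/-- A finite set of elements of a structure is the set of entries of a tuple without
repetitions. -/
theorem exists_tuple_entries_eq {P : Struct S} {X : Set P.Elem} (hX : X.Finite) :
    ∃ (Γ : List S.Sorts) (x : Tuple P.carrier Γ),
      Function.Injective (fun i => (⟨Γ.get i, x i⟩ : P.Elem)) ∧ Tuple.entries x = X := by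
  induction X, hX using Set.Finite.induction_on with
  | empty =>
    refine ⟨[], fun i => i.elim0, fun i => i.elim0, ?_⟩
    ext p
    simp only [Set.mem_empty_iff_false, iff_false]
    rintro ⟨i, -⟩
    exact i.elim0
  | @insert p X hp _ ih =>
    obtain ⟨Γ, x, hx, rfl⟩ := ih
    refine ⟨p.1 :: Γ, Tuple.cons p.2 x, ?_, ?_⟩
    · intro i j
      refine Fin.cases ?_ (fun i => ?_) i <;> refine Fin.cases ?_ (fun j => ?_) j
      · exact fun _ => rfl
      · exact fun h => (hp ⟨j, h.symm⟩).elim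
      · exact fun h => (hp ⟨i, h⟩).elim
      · exact fun h => congrArg Fin.succ (hx h)
    · ext q
      constructor
      · rintro ⟨i, rfl⟩
        refine Fin.cases ?_ (fun i => ?_) i
        · exact Set.mem_insert _ _
        · exact Set.mem_insert_of_mem _ ⟨i, rfl⟩
      · rintro (rfl | ⟨i, rfl⟩)
        · exact ⟨(0 : Fin (Γ.length + 1)), rfl⟩
        · exact ⟨i.succ, rfl⟩

/-- Absence of repetitions makes the prescription x ↦ c single-valued; the assignment may be
undefined off the entries of x. -/
theorem exists_assignment_mapsTo {P A : Struct S} {Γ : List S.Sorts} {x : Tuple P.carrier Γ}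
    (hx : Function.Injective (fun i => (⟨Γ.get i, x i⟩ : P.Elem))) (c : Tuple A.carrier Γ) :
    ∃ d : Assignment P A, d.MapsTo x c := by
  classical
  have h : ∀ p : P.Elem, ∃ o : Option (A.carrier p.1), ∀ i (h : ⟨Γ.get i, x i⟩ = p),
      o = some (congrArg Sigma.fst h ▸ c i) := by
    intro p
    by_cases hp : ∃ i, ⟨Γ.get i, x i⟩ = p
    · obtain ⟨i, rfl⟩ := hp
      refine ⟨some (c i), fun j hj => ?_⟩
      obtain rfl := hx hj
      rfl
    · exact ⟨none, fun i h => (hp ⟨i, h⟩).elim⟩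
  choose d hd using h
  exact ⟨d, fun i => hd _ i rfl⟩

/-- The term is a variable. The existential form absorbs the equality of sorts between `Γ.get i` and
`p.1`, so that later arguments need no casts. -/
theorem exists_term_of_mem_entries {P : Struct S} {Γ : List S.Sorts} {x : Tuple P.carrier Γ}
    {p : P.Elem} (hp : p ∈ Tuple.entries x) :
    ∃ t : Term S Γ p.1, ∀ (A : Struct S) (d : Assignment P A) (c : Tuple A.carrier Γ),
      d.MapsTo x c → d p = some (t.eval A c) := by
  obtain ⟨i, rfl⟩ := hp
  exact ⟨.var i, fun A d c h => h i⟩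

/-- Finitely many facts about the entries of a tuple are expressed by one quantifier-free
formula. -/
theorem exists_formula_of_facts {P : Struct S} {Γ : List S.Sorts} (x : Tuple P.carrier Γ)
    (F : Finset (Fact P)) (hF : factSupport F ⊆ Tuple.entries x) :
    ∃ ψ : RegFormula S Γ, ψ.IsQF ∧ ∀ (A : Struct S) (d : Assignment P A) (c : Tuple A.carrier Γ),
      d.MapsTo x c → (ψ.Realize A c ↔ d.Sat F) := by
  classical
  induction F using Finset.induction_on with
  | empty => exact ⟨.top, trivial, fun A d c _ => ⟨fun _ f hf => by simp at hf, fun _ => trivial⟩⟩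
  | insert f F _ ih =>
    obtain ⟨ψ, hψ, h⟩ := ih ((factSupport_mono (Finset.subset_insert f F)).trans hF)
    have hvar := fun k => exists_term_of_mem_entries (P := P) (x := x)
      (hF ⟨f, Finset.mem_insert_self f F, k, rfl⟩)
    choose σ hσ using hvar
    refine ⟨.and (f.form.subst σ) ψ, ⟨f.qf.subst σ, hψ⟩, fun A d c hc => ?_⟩
    have hf : (f.form.subst σ).Realize A c ↔ f.Sat d := by
      rw [RegFormula.realize_subst]
      refine ⟨fun h => ⟨_, fun k => hσ k A d c hc, h⟩, ?_⟩
      rintro ⟨y, hy, h⟩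
      rwa [hy.unique fun k => hσ k A d c hc] at h
    change _ ∧ _ ↔ _
    rw [hf, h A d c hc]
    simp [Assignment.Sat]

/-- A finitely presentable model is presented by a cartesian formula, on a tuple that may be chosen
to contain any given finite set of elements. -/
theorem exists_isPresentedBy (hT : T.IsCartesian) (P : Mod T) [IsFinitelyPresentable.{u} P]
    (X : Finset P.obj.Elem) :
    ∃ (Γ : List S.Sorts) (ψ : RegFormula S Γ) (x : Tuple P.obj.carrier Γ),
      IsCartesianOver T ψ ∧ IsPresentedBy P ψ x ∧ (X : Set P.obj.Elem) ⊆ Tuple.entries x := by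
  classical
  obtain ⟨E, hE⟩ := exists_finite_generatedBy hT P
  -- Requiring F to mention E ∪ X puts both the generators and the prescribed elements into the
  -- presenting tuple, which lists the support of F.
  obtain ⟨F, hF, hX, hhom⟩ := exists_facts_forall_exists_hom P E hE (E ∪ X)
  obtain ⟨Γ, x, hinj, hx⟩ := exists_tuple_entries_eq (finite_factSupport F)
  obtain ⟨ψ, hqf, hψ⟩ := exists_formula_of_facts x F hx.ge
  rw [Finset.coe_union, Set.union_subset_iff, ← hx] at hX
  refine ⟨Γ, ψ, x, hqf.isCartesianOver T, ⟨?_, fun A c hc => ?_⟩, hX.2⟩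
  · exact (hψ P.obj (Struct.Hom.assignment (𝟙 P.obj)) x fun i => rfl).2
      (Struct.Hom.sat_assignment _ F)
  · obtain ⟨d, hd⟩ := exists_assignment_mapsTo hinj c
    have hsat := (hψ A.obj d c hd).1 hc
    obtain ⟨h, hh⟩ := hhom A d hsat
    -- The homomorphism is only known to agree with d on E; as E determines F, it agrees with d on
    -- the whole support of F, that is, on x.
    have hdet := hF A.obj A.property d h.hom.assignment hsat (h.hom.sat_assignment F) hh
    refine ⟨h, funext fun i => ?_, fun h' hh' => ?_⟩
    · have := hdet ⟨_, x i⟩ (hx ▸ ⟨i, rfl⟩)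
      rw [hd i] at this
      exact (Option.some.inj this).symm
    · refine ObjectProperty.hom_ext _ (Struct.Hom.ext ?_)
      funext s z
      -- Uniqueness: two homomorphisms with the same values on x agree on E, and each element z is
      -- determined by E through some fact set G.
      obtain ⟨G, hG, hz⟩ := hE ⟨s, z⟩
      refine Option.some.inj (hG A.obj A.property h'.hom.assignment h.hom.assignment
        (h'.hom.sat_assignment G) (h.hom.sat_assignment G) (fun p hp => ?_) ⟨s, z⟩ hz)
      rw [← hh p hp]
      obtain ⟨i, rfl⟩ := hX.1 hp
      rw [hd i, ← hh']
      rfl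

end Presentation

/-! ### Path embeddings in a category with a stable factorisation system -/

section Paths

variable {C : Type w} [Category.{v} C] {Q M : MorphismProperty C}

namespace IsStableFactorizationSystem

theorem hasLiftingProperty (h : IsStableFactorizationSystem Q M) {X Y Z W : C} {e : X ⟶ Y}
    {m : Z ⟶ W} (he : Q e) (hm : M m) : HasLiftingProperty e m := by
  rw [← h.weak.rlp] at hm
  exact hm e he

/-- Embeddings are the morphisms with the right lifting property against Q. A square against f is
lifted after composing with g, and the second triangle is recovered by cancelling the monomorphism
g. -/
theorem of_comp (h : IsStableFactorizationSystem Q M) {X Y Z : C} {f : X ⟶ Y} {g : Y ⟶ Z}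
    (hg : M g) (hfg : M (f ≫ g)) : M f := by
  rw [← h.weak.rlp]
  intro A B e he
  have := h.mono g hg
  have := h.hasLiftingProperty he hfg
  refine ⟨fun {u k} sq => ⟨⟨?_⟩⟩⟩
  have sq' : CommSq u e (f ≫ g) (k ≫ g) := ⟨by rw [← Category.assoc, sq.w, Category.assoc]⟩
  refine { l := sq'.lift, fac_left := sq'.fac_left, fac_right := ?_ }
  rw [← cancel_mono g, Category.assoc, sq'.fac_right]

theorem comp_mem (h : IsStableFactorizationSystem Q M) {X Y Z : C} {f : X ⟶ Y} {g : Y ⟶ Z}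
    (hf : M f) (hg : M g) : M (f ≫ g) := by
  rw [← h.weak.rlp] at hf hg ⊢
  exact Q.rlp.comp_mem _ _ hf hg

theorem iso_comp_mem (h : IsStableFactorizationSystem Q M) {X Y Z : C} (i : X ≅ Y) {g : Y ⟶ Z}
    (hg : M g) : M (i.hom ≫ g) := by
  rw [← h.weak.rlp] at hg ⊢
  exact Q.rlp.comp_mem _ _ (Q.rlp.of_isIso i.hom) hg

theorem iso_mem (h : IsStableFactorizationSystem Q M) {X Y : C} (i : X ≅ Y) : M i.hom := by
  rw [← h.weak.rlp]
  exact Q.rlp.of_isIso i.hom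

end IsStableFactorizationSystem

theorem subobject_le_iff {X : C} {m n : Subobject X} :
    m ≤ n ↔ ∃ k : (m : C) ⟶ (n : C), k ≫ n.arrow = m.arrow :=
  ⟨fun h => ⟨m.ofLE n h, Subobject.ofLE_arrow h⟩, fun ⟨k, hk⟩ => Subobject.le_of_comm k hk⟩

theorem IsPath.of_iso (h : IsStableFactorizationSystem Q M) {P P' : C} (e : P' ≅ P)
    (hP : IsPath M P) : IsPath M P' := by
  have key : ∀ m : Emb M P', M ((Subobject.mapIsoToOrderIso e) m.1).arrow := by
    rintro ⟨m, hm⟩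
    have : (Subobject.mapIsoToOrderIso e) m = Subobject.mk (m.arrow ≫ e.hom) := by
      rw [Subobject.mapIsoToOrderIso_apply, ← Subobject.map_mk, Subobject.mk_arrow]
    rw [this, ← Subobject.underlyingIso_hom_comp_eq_mk]
    exact h.iso_comp_mem _ (h.comp_mem hm (h.iso_mem e))
  let F : Emb M P' ↪o Emb M P :=
    { toFun := fun m => ⟨_, key m⟩
      inj' := fun m n hmn => Subtype.ext
        ((Subobject.mapIsoToOrderIso e).injective (congrArg Subtype.val hmn))
      map_rel_iff' := (Subobject.mapIsoToOrderIso e).le_iff_le }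
  obtain ⟨hfin, hchain⟩ := hP
  exact ⟨Finite.of_injective F F.injective, fun m n =>
    (hchain (F m) (F n)).imp F.le_iff_le.1 F.le_iff_le.1⟩

/-- The path embedding `m` is the subobject represented by `f`. -/
def PathEmb.RepresentedBy {X P : C} (m : PathEmb M X) (f : P ⟶ X) : Prop :=
  ∃ i : P ≅ (m.1.1 : C), i.hom ≫ m.1.1.arrow = f

theorem PathEmb.representedBy_arrow {X : C} (m : PathEmb M X) :
    m.RepresentedBy m.1.1.arrow :=
  ⟨Iso.refl _, Category.id_comp _⟩

theorem PathEmb.exists_representedBy (h : IsStableFactorizationSystem Q M) {X P : C} {f : P ⟶ X}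
    (hf : M f) (hP : IsPath M P) : ∃ m : PathEmb M X, m.RepresentedBy f := by
  have := h.mono f hf
  refine ⟨⟨⟨Subobject.mk f, ?_⟩, hP.of_iso h (Subobject.underlyingIso f)⟩,
    (Subobject.underlyingIso f).symm, Subobject.underlyingIso_arrow f⟩
  rw [← Subobject.underlyingIso_hom_comp_eq_mk]
  exact h.iso_comp_mem _ hf

/-- Expressing the order by arbitrary representing morphisms lets path embeddings into different
objects be compared through a common domain. -/
theorem PathEmb.le_iff {X P P' : C} {m m' : PathEmb M X} {f : P ⟶ X} {f' : P' ⟶ X}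
    (hm : m.RepresentedBy f) (hm' : m'.RepresentedBy f') :
    m ≤ m' ↔ ∃ k : P ⟶ P', k ≫ f' = f := by
  obtain ⟨i, rfl⟩ := hm
  obtain ⟨i', rfl⟩ := hm'
  refine subobject_le_iff.trans ⟨?_, ?_⟩
  · rintro ⟨k, hk⟩
    exact ⟨i.hom ≫ k ≫ i'.inv, by simp [hk]⟩
  · rintro ⟨k, hk⟩
    exact ⟨i.inv ≫ k ≫ i'.hom, by simp [hk]⟩

/-- Whether one path embedding covers another does not depend on the ambient object. -/
theorem PathEmb.covBy_of_covBy (h : IsStableFactorizationSystem Q M) {a b P P' : C} {j : P ⟶ P'}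
    {f : P' ⟶ a} {g : P' ⟶ b} (hf : M f) (hg : M g) {m m' : PathEmb M a} {n n' : PathEmb M b}
    (hm : m.RepresentedBy (j ≫ f)) (hm' : m'.RepresentedBy f) (hn : n.RepresentedBy (j ≫ g))
    (hn' : n'.RepresentedBy g) (hmm : m ⋖ m') : n ⋖ n' := by
  have := h.mono f hf
  have := h.mono g hg
  have hlt := hmm.lt.not_ge
  rw [PathEmb.le_iff hm' hm] at hlt
  refine ⟨lt_of_le_not_ge ((PathEmb.le_iff hn hn').2 ⟨j, rfl⟩) fun hle => hlt ?_, ?_⟩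
  -- If n' ≤ n, then k splits j; the same k would show m' ≤ m.
  · obtain ⟨k, hk⟩ := (PathEmb.le_iff hn' hn).1 hle
    have hkj : k ≫ j = 𝟙 _ := by rw [← cancel_mono g, Category.assoc, hk, Category.id_comp]
    exact ⟨k, by rw [← Category.assoc, hkj, Category.id_comp]⟩
  · intro q h₁ h₂
    have hnq := h₁.le
    have hqn := h₁.not_ge
    have hqn' := h₂.le
    have hnq' := h₂.not_ge
    have hq := q.representedBy_arrow
    rw [PathEmb.le_iff hn hq] at hnq
    rw [PathEmb.le_iff hq hn] at hqn
    rw [PathEmb.le_iff hq hn'] at hqn'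
    rw [PathEmb.le_iff hn' hq] at hnq'
    obtain ⟨l, hl⟩ := hqn'
    -- A path embedding strictly between n and n' factors through g by an embedding l into P'.
    -- Composing l with f instead gives one strictly between m and m'.
    have hlM : M l := h.of_comp hg (by rw [hl]; exact q.1.2)
    obtain ⟨q', hq'⟩ := PathEmb.exists_representedBy h (h.comp_mem hlM hf) q.2
    refine hmm.2 (c := q') (lt_of_le_not_ge ?_ ?_) (lt_of_le_not_ge ?_ ?_)
    · obtain ⟨r, hr⟩ := hnq
      rw [PathEmb.le_iff hm hq']
      have hrl : r ≫ l = j := by rw [← cancel_mono g, Category.assoc, hl, hr]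
      exact ⟨r, by rw [← Category.assoc, hrl]⟩
    · rw [PathEmb.le_iff hq' hm]
      rintro ⟨k, hk⟩
      have hkj : k ≫ j = l := by rw [← cancel_mono f, Category.assoc, hk]
      exact hqn ⟨k, by rw [← Category.assoc, hkj, hl]⟩
    · exact (PathEmb.le_iff hq' hm').2 ⟨l, rfl⟩
    · rw [PathEmb.le_iff hm' hq']
      rintro ⟨k, hk⟩
      have hkl : k ≫ l = 𝟙 _ := by
        rw [← cancel_mono f, Category.assoc, hk, Category.id_comp]
      exact hnq' ⟨k, by rw [← hl, ← Category.assoc, hkl, Category.id_comp]⟩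

/-- A path embedding whose domain is a quotient of an initial object is the least one. -/
theorem PathEmb.isBot_of_isInitial (h : IsStableFactorizationSystem Q M) {O P X : C}
    (hO : Limits.IsInitial O) {e : O ⟶ P} (he : Q e) {f : P ⟶ X} {m : PathEmb M X}
    (hm : m.RepresentedBy f) : IsBot m := by
  intro n
  rw [PathEmb.le_iff hm n.representedBy_arrow]
  have := h.hasLiftingProperty he n.1.2
  have sq : CommSq (hO.to _) e n.1.1.arrow f := ⟨hO.hom_ext _ _⟩
  exact ⟨sq.lift, sq.fac_right⟩

/-- A quotient of an initial object is a path. -/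
theorem isPath_of_isInitial (h : IsStableFactorizationSystem Q M) {O P : C}
    (hO : Limits.IsInitial O) {e : O ⟶ P} (he : Q e) : IsPath M P := by
  have key : ∀ m n : Emb M P, m ≤ n := by
    intro m n
    have := h.hasLiftingProperty he n.2
    -- A diagonal of this square is a section of n, so every m factors through n and all embeddings
    -- into P coincide as subobjects.
    have sq : CommSq (hO.to _) e n.1.arrow (𝟙 P) := ⟨hO.hom_ext _ _⟩
    exact subobject_le_iff.2 ⟨m.1.arrow ≫ sq.lift, by
      rw [Category.assoc, sq.fac_right, Category.comp_id]⟩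
  have : Subsingleton (Emb M P) := ⟨fun m n => le_antisymm (key m n) (key n m)⟩
  exact ⟨inferInstance, fun m n => .inl (key m n)⟩

end Paths

/-! ### Winning strategies from back-and-forth systems -/

section Game

variable {C : Type w} [Category.{v} C] {M : MorphismProperty C} {a b : C}

open Classical in
/-- Duplicator wins from every position of a back-and-forth system of winning positions. -/
theorem duplicatorWins_of_system (R : PathEmb M a → PathEmb M b → Prop)
    (hwin : ∀ m n, R m n → Position.Winning (m, n))
    (hleft : ∀ m n m', R m n → m ⋖ m' → ∃ n', n ⋖ n' ∧ R m' n')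
    (hright : ∀ m n n', R m n → n ⋖ n' → ∃ m', m ⋖ m' ∧ R m' n')
    {m₀ : PathEmb M a} {n₀ : PathEmb M b} (h₀ : R m₀ n₀) : DuplicatorWins (m₀, n₀) := by
  -- Replies must be total functions, so an arbitrary value is returned where the hypotheses of the
  -- system fail.
  have hl : ∀ (m : PathEmb M a) (n : PathEmb M b) (m' : PathEmb M a), ∃ n',
      R m n → m ⋖ m' → n ⋖ n' ∧ R m' n' := by
    intro m n m'
    by_cases h : R m n ∧ m ⋖ m'
    · obtain ⟨n', hn'⟩ := hleft m n m' h.1 h.2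
      exact ⟨n', fun _ _ => hn'⟩
    · exact ⟨n, fun h₁ h₂ => (h ⟨h₁, h₂⟩).elim⟩
  have hr : ∀ (m : PathEmb M a) (n n' : PathEmb M b), ∃ m',
      R m n → n ⋖ n' → m ⋖ m' ∧ R m' n' := by
    intro m n n'
    by_cases h : R m n ∧ n ⋖ n'
    · obtain ⟨m', hm'⟩ := hright m n n' h.1 h.2
      exact ⟨m', fun _ _ => hm'⟩
    · exact ⟨m, fun h₁ h₂ => (h ⟨h₁, h₂⟩).elim⟩
  choose L hL using hl
  choose N hN using hr
  -- The strategy looks only at the current position. Reachable histories are nonempty, so the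
  -- default of `headD` is never used on them.
  let σ : Strategy M a b :=
    { replyRight := fun H m' => L (H.headD (m₀, n₀)).1 (H.headD (m₀, n₀)).2 m'
      replyLeft := fun H n' => N (H.headD (m₀, n₀)).1 (H.headD (m₀, n₀)).2 n' }
  have hR : ∀ H : List (Position M a b), σ.Reaches (m₀, n₀) H →
      R (H.headD (m₀, n₀)).1 (H.headD (m₀, n₀)).2 := by
    intro H hH
    induction hH with
    | start => exact h₀
    | left _ hm ih => exact (hL _ _ _ ih hm).2
    | right _ hn ih => exact (hN _ _ _ ih hn).2
  refine ⟨hwin _ _ h₀, σ, fun m n H hH => ⟨fun m' hm' => ?_, fun n' hn' => ?_⟩⟩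
  · have := hL m n m' (hR _ hH) hm'
    exact ⟨this.1, hwin _ _ this.2⟩
  · have := hN m n n' (hR _ hH) hn'
    exact ⟨this.1, hwin _ _ this.2⟩

end Game

/-! ### Transfer of path embeddings along `L_∞` types, and the main theorem -/

section Main

variable {S : Signature.{u}} {T : Theory S} {Q M : MorphismProperty (Mod T)}

/-- An embedding of a path into `a` can be copied to `b`, compatibly with given tuples of the same
type. -/
theorem exists_embedding_sameType (hdef : PathEmbeddingsDefinable T M) {a b P : Mod T}
    (hP : IsPath M P) {f : P ⟶ a} (hf : M f) {Γ : List S.Sorts} {e : Tuple a.obj.carrier Γ}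
    {e' : Tuple b.obj.carrier Γ} (he : SameType a.obj b.obj e e') (X : Finset P.obj.Elem) :
    ∃ (Δ : List S.Sorts) (ψ : RegFormula S Δ) (x : Tuple P.obj.carrier Δ) (g : P ⟶ b),
      M g ∧ IsPresentedBy P ψ x ∧ SameType a.obj b.obj (mapTuple f x) (mapTuple g x) ∧
        ∀ (k : Fin Γ.length) (z : P.obj.carrier (Γ.get k)), ⟨_, z⟩ ∈ X →
          e k = f.hom.toFun _ z → e' k = g.hom.toFun _ z := by
  have := hdef.finitelyPresentable P hP
  obtain ⟨Δ, ψ, x, hψ, hx, hX⟩ := exists_isPresentedBy hdef.cartesian P X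
  obtain ⟨θ, hθ⟩ := hdef.definable P hP Δ ψ x hψ hx
  -- The joint tuple of e and f(x) gets a counterpart in b. Its part over x is the tuple to which g
  -- will send x.
  obtain ⟨Θ, E, E', σ, τ, hE, rfl, rfl, hτ⟩ := he.exists_extend (mapTuple f x)
  have hτE := hE.eval τ
  rw [hτ] at hτE
  have hψ' : ψ.Realize b.obj fun i => (τ i).eval b.obj E' := by
    rw [← RegFormula.realize_toFormula, ← hτE, RegFormula.realize_toFormula]
    exact hx.1.map f.hom
  obtain ⟨g, hg, -⟩ := hx.2 b _ hψ'
  refine ⟨Δ, ψ, x, g, ?_, hx, ?_, ?_⟩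
  · rw [hθ b g, hg, ← hτE, ← hθ a f]
    exact hf
  · rwa [hg]
  · intro k z hz hk
    obtain ⟨t, ht⟩ := exists_term_of_mem_entries (hX hz)
    have htf := Option.some.inj (ht a.obj f.hom.assignment (mapTuple f x) fun i => rfl)
    have htg := Option.some.inj (ht b.obj g.hom.assignment (mapTuple g x) fun i => rfl)
    -- Since z is an entry of x, the coincidence e k = f(z) is an equation between terms in the
    -- joint tuple and so transfers to b.
    have heq := (hE (.eq (σ k) (t.subst τ))).1 (by
      change (σ k).eval a.obj E = (t.subst τ).eval a.obj E
      rw [Term.eval_subst, hτ]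
      exact hk.trans htf)
    change (σ k).eval b.obj E' = (t.subst τ).eval b.obj E' at heq
    rw [Term.eval_subst, ← hg] at heq
    exact heq.trans htg.symm

/-- Two path embeddings with the same domain, and with generators of the same `L_∞` type. -/
def Matched (M : MorphismProperty (Mod T)) {a b : Mod T} (m : PathEmb M a) (n : PathEmb M b) :
    Prop :=
  ∃ (P : Mod T) (f : P ⟶ a) (g : P ⟶ b) (Γ : List S.Sorts) (ψ : RegFormula S Γ)
    (x : Tuple P.obj.carrier Γ), m.RepresentedBy f ∧ n.RepresentedBy g ∧ IsPresentedBy P ψ x ∧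
      SameType a.obj b.obj (mapTuple f x) (mapTuple g x)

theorem Matched.symm {a b : Mod T} {m : PathEmb M a} {n : PathEmb M b} (h : Matched M m n) :
    Matched M n m := by
  obtain ⟨P, f, g, Γ, ψ, x, hm, hn, hx, h⟩ := h
  exact ⟨P, g, f, Γ, ψ, x, hn, hm, hx, h.symm⟩

theorem Matched.winning {a b : Mod T} {m : PathEmb M a} {n : PathEmb M b} (h : Matched M m n) :
    Position.Winning (m, n) := by
  obtain ⟨P, f, g, Γ, ψ, x, ⟨i, -⟩, ⟨j, -⟩, -⟩ := h
  exact ⟨i.symm ≪≫ j⟩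

/-- The domain of m' is copied into b over the type of f(x), with the images of the old generators x
among the new ones. This makes the copy extend the old embedding g, so that covering passes from a
to b. -/
theorem Matched.exists_covBy (hfs : IsStableFactorizationSystem Q M)
    (hdef : PathEmbeddingsDefinable T M) {a b : Mod T} {m m' : PathEmb M a} {n : PathEmb M b}
    (h : Matched M m n) (hmm : m ⋖ m') : ∃ n', n ⋖ n' ∧ Matched M m' n' := by
  classical
  obtain ⟨P, f, g, Γ, ψ, x, hm, hn, hx, hfg⟩ := h
  have hm' := m'.representedBy_arrow
  have hf' : M m'.1.1.arrow := m'.1.2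
  obtain ⟨j, rfl⟩ := (PathEmb.le_iff hm hm').1 hmm.le
  obtain ⟨Δ, χ, y, g', hg', hy, hsame, hX⟩ := exists_embedding_sameType hdef m'.2 hf' hfg
    (Finset.univ.image fun k => ⟨Γ.get k, mapTuple j x k⟩)
  -- Both morphisms send the presenting tuple x to g(x), so they coincide by the universal property
  -- of the presentation.
  have hgj : j ≫ g' = g := by
    refine (hx.2 b (mapTuple g x) (hx.1.map g.hom)).unique ?_ rfl
    funext k
    exact (hX k (mapTuple j x k) (Finset.mem_image_of_mem _ (Finset.mem_univ k)) rfl).symm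
  subst hgj
  obtain ⟨n', hn'⟩ := PathEmb.exists_representedBy hfs hg' m'.2
  exact ⟨n', PathEmb.covBy_of_covBy hfs hf' hg' hm hm' hn hn' hmm,
    _, _, g', Δ, χ, y, hm', hn', hy, hsame⟩

end Main

end Wooded

theorem mainTheorem2 {S : Wooded.Signature.{u}} (T : Wooded.Theory S)
    (Q M : MorphismProperty (Wooded.Mod T)) (hwooded : Wooded.IsWooded Q M)
    (hdef : Wooded.PathEmbeddingsDefinable T M) (a b : Wooded.Mod T)
    (hab : Wooded.LInfEquiv a.obj b.obj) :
    Wooded.BackAndForthEquiv M a b := by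
  have hfs := hwooded.stable
  have := hwooded.hasInitial
  have := hfs.weak.hasFactorization
  have hO : Limits.IsInitial (⊥_ Wooded.Mod T) := Limits.initialIsInitial
  -- The middle object of this factorisation is the domain of the root of a. Copying its embedding
  -- into b, starting from empty tuples, yields the root of b, because the domain is still a
  -- quotient of the initial object.
  let D := MorphismProperty.factorizationData Q M (hO.to a)
  have hP : Wooded.IsPath M D.Z := Wooded.isPath_of_isInitial hfs hO D.hi
  obtain ⟨Γ, ψ, x, g, hg, hx, hsame, -⟩ := Wooded.exists_embedding_sameType hdef hP D.hp
    (b := b) (Γ := []) (e := fun i => i.elim0) (e' := fun i => i.elim0) hab ∅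
  obtain ⟨m, hm⟩ := Wooded.PathEmb.exists_representedBy hfs D.hp hP
  obtain ⟨n, hn⟩ := Wooded.PathEmb.exists_representedBy hfs hg hP
  refine ⟨m, n, Wooded.PathEmb.isBot_of_isInitial hfs hO D.hi hm,
    Wooded.PathEmb.isBot_of_isInitial hfs hO D.hi hn,
    Wooded.duplicatorWins_of_system (Wooded.Matched M) (fun _ _ h => h.winning)
      (fun _ _ _ h hmm => h.exists_covBy hfs hdef hmm) (fun _ _ _ h hnn => ?_)
      ⟨_, _, g, Γ, ψ, x, hm, hn, hx, hsame⟩⟩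
  obtain ⟨m', hm', h'⟩ := h.symm.exists_covBy hfs hdef hnn
  exact ⟨m', hm', h'.symm⟩
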